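/- **Setting.** Let \(P\subseteq\mathbb R^n\) be a polytope (a bounded set of the form \(\{x : Ax\le a\}\)), let \(D\) be its diameter in the Euclidean norm \(\|\cdot\|_2\), and let \(k\) be (an upper bound on) its \(\ell_1\)-diameter, i.e. \(\|y-z\|_1\le k\) for all \(y,z\in P\). Let \(K\ge 1\), \(L\ge 0\) and \(\delta>0\). Let \(f_1,f_2,\dots\) be random functions that are i.i.d. (as random functions on \(P\)) with expectation \(f^*(x)=\mathbb E f_t(x)\) for \(x\in P\) (the \(f_t(x)\) being integrable); almost surely each \(f_t\) is convex and \(L\)-Lipschitz in the \(2\)-norm on a fixed open convex set \(U\supseteq P\). A convex \(g\) is called *smooth with curvature at most \(C\)* on \(P\) if it is differentiable at the points of \(P\) and \[g(\gamma y+(1-\gamma)x)\le g(x)+\gamma\nabla g(x)(y-x)+C\gamma^2/2\qquad(x,y\in P,\ 0\le\gamma\le1).\] **Weak separation oracle.** On input \((c,x,\Phi,K)\) it returns either a vertex \(y\) of \(P\) with \(c(x-y)>\Phi/K\), or \(\mathbf{false}\), in which case \(c(x-z)\le\Phi\) for all \(z\in P\). Where both answers are possible it may give either one, and its answers may depend on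 earlier calls. **Lazy Online Conditional Gradient** applied to functions \(g_1,g_2,\dots\) with parameters \(K\), \(C\), \(b<1\) and step sizes \(\gamma_t=t^{-(1-b)/2}\) starts at a vertex \(x_1\) of \(P\) and does the following for \(t=1,\dots,T-1\). Put \(h_1=\|\nabla g_1(x_1)\|_2D\), and \(h_t=\Phi_{t-1}+\|\nabla g_t(x_t)\|_2D\) for \(t\ge2\). Put \[\overline\Phi_t=\frac{h_t+\frac{C t^{1-b}\gamma_t^2}{2(1-b)}}{1+\gamma_t/K},\] and query the weak separation oracle at \(\bigl(\sum_{i=1}^t\nabla g_i(x_t),x_t,\overline\Phi_t,K\bigr)\). If it answers \(\mathbf{false}\), then \(x_{t+1}=x_t\) and \(\Phi_t=\overline\Phi_t\). If it returns a vertex \(v_t\), then \(x_{t+1}=(1-\gamma_t)x_t+\gamma_tv_t\) and \(\Phi_t=h_t-\sum_{i=1}^tg_i(x_t)+\sum_{i=1}^tg_i(x_{t+1})\). **Result.** There is a constant \(c>0\) that depends only on \(K\), such that in every such setting the following two statements hold. 1. *Smooth case.* Suppose that almost surely all the \(f_t\) are smooth with curvature at most \(C\) on \(P\), and let \(T\ge2\).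 Then with probability at least \(1-\delta\), every run of the algorithm on the \(f_t\) with parameters \(K\), \(C\), \(b=0\) (so \(\gamma_t=t^{-1/2}\)) satisfies \[\sum_{t=1}^Tf^*(x_t)-\min_{x\in P}\sum_{t=1}^Tf^*(x)\le c\Bigl(C\sqrt T+Lk\sqrt{nT\log(nT^2/\delta)\log T}\Bigr).\] 2. *Without smoothness.* Suppose that \(U\) contains every closed Euclidean ball of radius \(\sqrt n\,D\) around a point of \(P\), and let \(T\ge1\). Let \(\hat f_t(x)=\mathbb E_u f_t(x+\sqrt n\,D\,t^{-1/3}u)\), where \(u\) is uniformly distributed on the Euclidean unit ball, be the smoothing of \(f_t\) at radius \(\sqrt n\,D\,t^{-1/3}\). Then with probability at least \(1-\delta\), every run of the algorithm on the \(\hat f_t\) with parameters \(K\), \(C=4\sqrt n\,LD\), \(b=-1/3\) (so \(\gamma_t=t^{-2/3}\)) satisfies \[\sum_{t=1}^Tf^*(x_t)-\min_{x\in P}\sum_{t=1}^Tf^*(x)\le c\Bigl(\sqrt n\,Lk\,T^{2/3}+Lk\sqrt{nT\log(nT^2/\delta)\log T}\Bigr).\] In both statements the probability claim means that there is an event of probability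 at least \(1-\delta\) on which the bound holds for all runs, whatever the admissible oracle answers are. -/

import Mathlib

open MeasureTheory ProbabilityTheory
open scoped NNReal ENNReal

noncomputable section

namespace LazyOnline

/-- A polytope: a bounded set of the form `{x ∈ ℝⁿ | A x ≤ a}`. -/
def IsPolytope {n : ℕ} (P : Set (EuclideanSpace ℝ (Fin n))) : Prop :=
  Bornology.IsBounded P ∧
    ∃ (m : ℕ) (A : Matrix (Fin m) (Fin n) ℝ) (a : Fin m → ℝ),
      P = {x | ∀ i, ∑ j, A i j * x j ≤ a i}

/-- `f` is differentiable at the points of `P`, and smooth there with curvature at most `C`: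
`f (γ y + (1 - γ) x) ≤ f x + γ ∇f(x) (y - x) + C γ² / 2`. -/
def HasCurvatureAtMost {n : ℕ} (P : Set (EuclideanSpace ℝ (Fin n)))
    (f : EuclideanSpace ℝ (Fin n) → ℝ) (C : ℝ) : Prop :=
  (∀ x ∈ P, DifferentiableAt ℝ f x) ∧
    ∀ x ∈ P, ∀ y ∈ P, ∀ γ ∈ Set.Icc (0 : ℝ) 1,
      f (γ • y + (1 - γ) • x) ≤ f x + γ * inner ℝ (gradient f x) (y - x) + C * γ ^ 2 / 2

/-- `ans` is an admissible answer of a weak separation oracle for `P` on the input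
`(c, x, Φ, K)`: either a vertex `y` of `P` with `c (x - y) > Φ / K`, or `false` (here `none`),
which certifies `c (x - z) ≤ Φ` for all `z ∈ P`. Where both answers are possible, both are
admissible. -/
def IsWeakSepAnswer {n : ℕ} (P : Set (EuclideanSpace ℝ (Fin n)))
    (c x : EuclideanSpace ℝ (Fin n)) (Φ K : ℝ) :
    Option (EuclideanSpace ℝ (Fin n)) → Prop
  | some y => y ∈ P.extremePoints ℝ ∧ Φ / K < inner ℝ c (x - y)
  | none => ∀ z ∈ P, inner ℝ c (x - z) ≤ Φ

/-- The first gap bound `min {g D, 2 g² / S}`, where `g` is the norm of the current gradient;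
for `S = 0` (no strong convexity) the second entry of the minimum is `+∞`. -/
def gapInit (D S g : ℝ) : ℝ :=
  if S = 0 then g * D else min (g * D) (2 * g ^ 2 / S)

/-- The increment
`min {g D, g² / (S t^(1-s)) + 2 √(g² / (2 S t^(1-s)) (g² / (2 S t^(1-s)) + Φ))}`
of the gap bound in round `t`; for `S = 0` the second entry of the minimum is `+∞`. -/
def gapIncr (D S s : ℝ) (t : ℕ) (g Φ : ℝ) : ℝ :=
  if S = 0 then g * D
  else min (g * D)
    (g ^ 2 / (S * (t : ℝ) ^ (1 - s)) +
      2 * √(g ^ 2 / (2 * (S * (t : ℝ) ^ (1 - s))) *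
        (g ^ 2 / (2 * (S * (t : ℝ) ^ (1 - s))) + Φ)))

/-- The value `(h + C t^(1-b) γ² / (2 (1-b))) / (1 + γ / K)` that is handed to the oracle in
round `t`, for the gap bound `h` and the step size `γ`. -/
def oracleValue (K C b : ℝ) (γ : ℝ) (t : ℕ) (h : ℝ) : ℝ :=
  (h + C * (t : ℝ) ^ (1 - b) * γ ^ 2 / (2 * (1 - b))) / (1 + γ / K)

/-- A run of the lazy online conditional gradient algorithm on the losses `f 1, f 2, …` over `P`
up to time `T`, in the Euclidean norm, with parameters `K, C, b, S, s`, the Euclidean diameter of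
`P` as `D`, and step sizes `γ t`. The points are `x 1, …, x T`; `h t` is the gap bound of round
`t`, `Φ t` is the value of `Φ` at the end of round `t`, and `v t` is the answer of the oracle
in round `t`, for `1 ≤ t ≤ T - 1`. The oracle may give any admissible answer; it may in
particular remember earlier calls. -/
structure IsLOCGRun {n : ℕ} (P : Set (EuclideanSpace ℝ (Fin n))) (K C b S s : ℝ) (γ : ℕ → ℝ)
    (f : ℕ → EuclideanSpace ℝ (Fin n) → ℝ) (T : ℕ)
    (x : ℕ → EuclideanSpace ℝ (Fin n)) (h Φ : ℕ → ℝ)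
    (v : ℕ → Option (EuclideanSpace ℝ (Fin n))) : Prop where
  start : x 1 ∈ P.extremePoints ℝ
  gap_one : 1 < T → h 1 = gapInit (Metric.diam P) S ‖gradient (f 1) (x 1)‖
  gap_succ : ∀ t, 1 ≤ t → t + 1 < T →
    h (t + 1) = Φ t +
      gapIncr (Metric.diam P) S s (t + 1) ‖gradient (f (t + 1)) (x (t + 1))‖ (Φ t)
  oracle : ∀ t, 1 ≤ t → t < T →
    IsWeakSepAnswer P (∑ i ∈ Finset.Icc 1 t, gradient (f i) (x t)) (x t)
      (oracleValue K C b (γ t) t (h t)) K (v t)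
  negative : ∀ t, 1 ≤ t → t < T → v t = none →
    x (t + 1) = x t ∧ Φ t = oracleValue K C b (γ t) t (h t)
  positive : ∀ t, 1 ≤ t → t < T → ∀ y, v t = some y →
    x (t + 1) = (1 - γ t) • x t + γ t • y ∧
      Φ t = h t - ∑ i ∈ Finset.Icc 1 t, f i (x t) + ∑ i ∈ Finset.Icc 1 t, f i (x (t + 1))

/-- The ball smoothing `x ↦ 𝔼 f (x + r u)` of `f` at radius `r`, where `u` is uniformly
distributed on the Euclidean unit ball. -/
def smoothing {n : ℕ} (r : ℝ) (f : EuclideanSpace ℝ (Fin n) → ℝ) :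
    EuclideanSpace ℝ (Fin n) → ℝ :=
  fun x => ⨍ u in Metric.closedBall (0 : EuclideanSpace ℝ (Fin n)) 1, f (x + r • u)

/-- The losses `f 1, f 2, …` are, as random functions on the feasible region `P`, independent
and identically distributed with mean `fstar`; almost surely each of them is convex and
`L`-Lipschitz in the Euclidean norm on the open set `U`, which contains `P`. -/
structure IsIIDConvexLipschitz {n : ℕ} {Ω : Type*} [MeasurableSpace Ω] (μ : Measure Ω)
    (P U : Set (EuclideanSpace ℝ (Fin n))) (L : ℝ≥0)
    (f : ℕ → Ω → EuclideanSpace ℝ (Fin n) → ℝ)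
    (fstar : EuclideanSpace ℝ (Fin n) → ℝ) : Prop where
  isOpen : IsOpen U
  subset : P ⊆ U
  indep : iIndepFun (fun (t : ℕ) (ω : Ω) (x : P) => f (t + 1) ω x) μ
  ident : ∀ t, 1 ≤ t →
    IdentDistrib (fun (ω : Ω) (x : P) => f t ω x) (fun (ω : Ω) (x : P) => f 1 ω x) μ μ
  integrable : ∀ t, 1 ≤ t → ∀ x ∈ P, Integrable (fun ω => f t ω x) μ
  mean : ∀ t, 1 ≤ t → ∀ x ∈ P, ∫ ω, f t ω x ∂μ = fstar x
  convex : ∀ t, 1 ≤ t → ∀ᵐ ω ∂μ, ConvexOn ℝ U (f t ω)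
  lipschitz : ∀ t, 1 ≤ t → ∀ᵐ ω ∂μ, LipschitzOnWith L (f t ω) U

/-- The regret `∑_{t=1}^T g (x t) - min_{y ∈ P} ∑_{t=1}^T g y` is at most `B`
(and the minimum exists). -/
def RegretAtMost {n : ℕ} (P : Set (EuclideanSpace ℝ (Fin n)))
    (g : EuclideanSpace ℝ (Fin n) → ℝ) (T : ℕ)
    (x : ℕ → EuclideanSpace ℝ (Fin n)) (B : ℝ) : Prop :=
  ∃ y ∈ P, IsMinOn (fun z => ∑ _t ∈ Finset.Icc 1 T, g z) P y ∧
    ∑ t ∈ Finset.Icc 1 T, g (x t) - ∑ _t ∈ Finset.Icc 1 T, g y ≤ B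

end LazyOnline

end

namespace LazyOnline

/-! Fix a comparison point z. Then t (f*(x_t) - f*(z)) is at most the observed regret ∑_{i≤t}
(f_i(x_t) - f_i(z)) plus the deviation of these sums from their means. Both are bounded at every
time t; dividing by t and summing gives the regret (`sum_le_of_mul_le`).

The observed regret is controlled deterministically (`IsLOCGRun.sum_sub_sum_le`), with the invariant
that h_t bounds it and h_t ≤ A/γ_t. The oracle value Φ̄ solves Φ̄ (1 + γ/K) = h + e_t, where e_t is
the curvature error of a step. So a returned vertex lowers the cumulative loss enough to give Φ_t ≤
Φ̄, while a negative answer certifies Φ̄ itself. The next loss adds at most G D, and A = K (e + 2 G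
D) makes the invariant reproduce itself.

The deviation is bounded on one event for all pairs of points of P, by Hoeffding's inequality on a
net and a union bound (`IsIIDConvexLipschitz.exists_uniform_deviation`). Uniformity is essential:
x_t depends on the losses and on arbitrary oracle answers. It also makes the event independent of
the run.

Without smoothness, ball smoothing at radius r has curvature at most 2 n L D² / r, by comparing
shifted balls, and changes a loss by at most L r (`smoothing_properties`). It enters only the
deterministic part; concentration is applied to the f_t themselves. -/

/-! ### Deterministic bound on the observed regret -/

/-- One round of the recursion h ↦ (h + e)/(1 + γ/K) + D. A bound H is preserved once e + D (1 +
γ/K) ≤ H γ/K; since γ/K ≤ 1, H = K (e + 2 D)/γ suffices. -/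
theorem oracleValue_add_le {K C b γ h e D : ℝ} {t : ℕ} (hK : 1 ≤ K) (hγ : 0 < γ) (hγ1 : γ ≤ 1)
    (hD : 0 ≤ D) (he : C * (t : ℝ) ^ (1 - b) * γ ^ 2 / (2 * (1 - b)) ≤ e)
    (hh : h ≤ K * (e + 2 * D) / γ) :
    oracleValue K C b γ t h + D ≤ K * (e + 2 * D) / γ := by
  have hK0 : 0 < K := by linarith
  have hγK : 0 < γ / K := div_pos hγ hK0
  have hγK1 : γ / K ≤ 1 := (div_le_one hK0).2 (hγ1.trans hK)
  have hA : K * (e + 2 * D) / γ * (γ / K) = e + 2 * D := by field_simp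
  rw [← le_sub_iff_add_le, oracleValue, div_le_iff₀ (by linarith)]
  nlinarith [mul_le_mul_of_nonneg_left hγK1 hD]

/-- Along a run of the algorithm, the regret of the current point with respect to the losses seen
so far is at most `K (e + 2 G D) / γ t`. -/
theorem IsLOCGRun.sum_sub_sum_le {n : ℕ} {P : Set (EuclideanSpace ℝ (Fin n))} {K C b e G : ℝ}
    {γ : ℕ → ℝ} {g : ℕ → EuclideanSpace ℝ (Fin n) → ℝ} {T : ℕ}
    {x : ℕ → EuclideanSpace ℝ (Fin n)} {h Φ : ℕ → ℝ}
    {v : ℕ → Option (EuclideanSpace ℝ (Fin n))}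
    (run : IsLOCGRun P K C b 0 0 γ g T x h Φ v)
    (hP : Convex ℝ P) (hbd : Bornology.IsBounded P) (hK : 1 ≤ K) (he : 0 ≤ e) (hG : 0 ≤ G)
    (hγ : ∀ t, 1 ≤ t → 0 < γ t ∧ γ t ≤ 1) (hγa : ∀ t, 1 ≤ t → γ (t + 1) ≤ γ t)
    (hfo : ∀ t, 1 ≤ t → ∀ y ∈ P, ∀ z ∈ P, g t y - g t z ≤ inner ℝ (gradient (g t) y) (y - z))
    (hgrad : ∀ t, 1 ≤ t → ∀ y ∈ P, ‖gradient (g t) y‖ ≤ G)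
    (hval : ∀ t : ℕ, 1 ≤ t → C * (t : ℝ) ^ (1 - b) * γ t ^ 2 / (2 * (1 - b)) ≤ e)
    (hcurv : ∀ t : ℕ, 1 ≤ t → ∀ y ∈ P, ∀ z ∈ P,
      ∑ i ∈ Finset.Icc 1 t, g i (γ t • z + (1 - γ t) • y) ≤ ∑ i ∈ Finset.Icc 1 t, g i y +
        γ t * inner ℝ (∑ i ∈ Finset.Icc 1 t, gradient (g i) y) (z - y) +
        C * (t : ℝ) ^ (1 - b) * γ t ^ 2 / (2 * (1 - b)))
    (t : ℕ) (ht : 1 ≤ t) (htT : t ≤ T) :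
    x t ∈ P ∧ ∀ z ∈ P, ∑ i ∈ Finset.Icc 1 t, g i (x t) - ∑ i ∈ Finset.Icc 1 t, g i z ≤
      K * (e + 2 * (G * Metric.diam P)) / γ t := by
  have hK0 : 0 < K := by linarith
  set D := Metric.diam P with hDdef
  have hD : 0 ≤ D := Metric.diam_nonneg
  have hGD : 0 ≤ G * D := mul_nonneg hG hD
  set A := K * (e + 2 * (G * D)) with hA
  have hA0 : 0 ≤ A := by positivity
  have hone : ∀ t, 1 ≤ t → ∀ y ∈ P, ∀ z ∈ P, g t y - g t z ≤ ‖gradient (g t) y‖ * D := by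
    intro t ht y hy z hz
    refine (hfo t ht y hy z hz).trans ((real_inner_le_norm _ _).trans ?_)
    gcongr
    rw [← dist_eq_norm]
    exact Metric.dist_le_diam_of_mem hbd hy hz
  have hgD : ∀ t, 1 ≤ t → ∀ y ∈ P, ‖gradient (g t) y‖ * D ≤ G * D := fun t ht y hy =>
    mul_le_mul_of_nonneg_right (hgrad t ht y hy) hD
  have hlin : ∀ t, ∀ y ∈ P, ∀ z ∈ P,
      ∑ i ∈ Finset.Icc 1 t, g i y - ∑ i ∈ Finset.Icc 1 t, g i z ≤
        inner ℝ (∑ i ∈ Finset.Icc 1 t, gradient (g i) y) (y - z) := by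
    intro t y hy z hz
    rw [← Finset.sum_sub_distrib, sum_inner]
    exact Finset.sum_le_sum fun i hi => hfo i (Finset.mem_Icc.1 hi).1 y hy z hz
  -- A run constrains `h t` only for `t < T`, so the regret bound at `t = T` is carried separately
  -- from the invariant on `h`.
  suffices H : ∀ t, 1 ≤ t → t ≤ T → x t ∈ P ∧
      (∀ z ∈ P, ∑ i ∈ Finset.Icc 1 t, g i (x t) - ∑ i ∈ Finset.Icc 1 t, g i z ≤ A / γ t) ∧
      (t < T → h t ≤ A / γ t ∧
        ∀ z ∈ P, ∑ i ∈ Finset.Icc 1 t, g i (x t) - ∑ i ∈ Finset.Icc 1 t, g i z ≤ h t) from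
    ⟨(H t ht htT).1, (H t ht htT).2.1⟩
  intro t ht
  induction t, ht using Nat.le_induction with
  | base =>
    intro _
    have hx : x 1 ∈ P := run.start.1
    have hAγ : G * D ≤ A / γ 1 := by
      rw [le_div_iff₀ (hγ 1 le_rfl).1, hA]
      nlinarith [(hγ 1 le_rfl).2, mul_le_mul_of_nonneg_left (hγ 1 le_rfl).2 hGD,
        mul_nonneg (sub_nonneg.2 hK) (add_nonneg he (mul_nonneg zero_le_two hGD))]
    refine ⟨hx, fun z hz => ?_, fun h1 => ?_⟩
    · simpa using ((hone 1 le_rfl _ hx z hz).trans (hgD 1 le_rfl _ hx)).trans hAγ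
    -- The run has strong convexity parameter `S = 0`, so the gap bound reduces to ‖∇‖ D.
    · rw [run.gap_one h1, gapInit, if_pos rfl]
      exact ⟨(hgD 1 le_rfl _ hx).trans hAγ, fun z hz => by simpa using hone 1 le_rfl _ hx z hz⟩
  | succ t ht ih =>
    intro htT
    have htT' : t < T := htT
    obtain ⟨hx, -, ih2⟩ := ih htT'.le
    obtain ⟨hh, hgap⟩ := ih2 htT'
    obtain ⟨hγ0, hγ1⟩ := hγ t ht
    have hstep : oracleValue K C b (γ t) t (h t) + G * D ≤ A / γ t :=
      oracleValue_add_le hK hγ0 hγ1 hGD (hval t ht) hh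
    have hnext : A / γ t ≤ A / γ (t + 1) :=
      div_le_div_of_nonneg_left hA0 (hγ (t + 1) (by omega)).1 (hγa t ht)
    have key : x (t + 1) ∈ P ∧ Φ t ≤ oracleValue K C b (γ t) t (h t) ∧
        ∀ z ∈ P, ∑ i ∈ Finset.Icc 1 t, g i (x (t + 1)) - ∑ i ∈ Finset.Icc 1 t, g i z ≤ Φ t := by
      have hor := run.oracle t ht htT'
      rcases hv : v t with _ | y
      · obtain ⟨hx1, hΦ⟩ := run.negative t ht htT' hv
        rw [hv] at hor
        rw [hx1, hΦ]
        exact ⟨hx, le_rfl, fun z hz => (hlin t _ hx z hz).trans (hor z hz)⟩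
      · obtain ⟨hx1, hΦ⟩ := run.positive t ht htT' y hv
        rw [hv] at hor
        obtain ⟨hy, hsep⟩ := hor
        have hx1' : x (t + 1) = γ t • y + (1 - γ t) • x t := by rw [hx1, add_comm]
        refine ⟨?_, ?_, fun z hz => ?_⟩
        · rw [hx1]
          exact hP hx hy.1 (by linarith) hγ0.le (by ring)
        · have hc := hcurv t ht _ hx y hy.1
          rw [← hx1'] at hc
          have hneg : inner ℝ (∑ i ∈ Finset.Icc 1 t, gradient (g i) (x t)) (y - x t) =
              -inner ℝ (∑ i ∈ Finset.Icc 1 t, gradient (g i) (x t)) (x t - y) := by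
            rw [← inner_neg_right, neg_sub]
          rw [hneg] at hc
          -- The step gains more than γ Φ̄/K to first order and loses at most the curvature term;
          -- the defining equation of Φ̄ turns this into Φ_t ≤ Φ̄.
          have hmul := mul_lt_mul_of_pos_left hsep hγ0
          have hdef : oracleValue K C b (γ t) t (h t) * (1 + γ t / K) =
              h t + C * (t : ℝ) ^ (1 - b) * γ t ^ 2 / (2 * (1 - b)) := by
            rw [oracleValue]
            exact div_mul_cancel₀ _ (by positivity)
          have : γ t * (oracleValue K C b (γ t) t (h t) / K) =
              oracleValue K C b (γ t) t (h t) * (γ t / K) := by ring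
          linarith
        · have := hgap z hz
          linarith
    obtain ⟨hx1, hΦ, hgap1⟩ := key
    have hsum : ∀ z ∈ P, ∑ i ∈ Finset.Icc 1 (t + 1), g i (x (t + 1)) -
        ∑ i ∈ Finset.Icc 1 (t + 1), g i z ≤ Φ t + ‖gradient (g (t + 1)) (x (t + 1))‖ * D := by
      intro z hz
      rw [Finset.sum_Icc_succ_top (by omega), Finset.sum_Icc_succ_top (by omega)]
      linarith [hgap1 z hz, hone (t + 1) (by omega) _ hx1 z hz]
    have hle := hgD (t + 1) (by omega) _ hx1
    refine ⟨hx1, fun z hz => ?_, fun ht1 => ?_⟩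
    · linarith [hsum z hz]
    · rw [run.gap_succ t ht ht1, gapIncr, if_pos rfl]
      exact ⟨by linarith, hsum⟩

/-- Restricted to the segment from y to z, the slope of a convex function over [0, 1] dominates its
derivative at 0. -/
theorem convexOn_sub_le_inner_gradient {n : ℕ} {P : Set (EuclideanSpace ℝ (Fin n))}
    {g : EuclideanSpace ℝ (Fin n) → ℝ} (hg : ConvexOn ℝ P g) {y z : EuclideanSpace ℝ (Fin n)}
    (hy : y ∈ P) (hz : z ∈ P) (hd : DifferentiableAt ℝ g y) :
    g y - g z ≤ inner ℝ (gradient g y) (y - z) := by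
  have hline : HasDerivAt (fun s : ℝ => AffineMap.lineMap (k := ℝ) y z s) (z - y) 0 := by
    simpa using AffineMap.hasDerivAt_lineMap (a := y) (b := z) (x := (0 : ℝ))
  have hder : HasDerivAt (g ∘ fun s : ℝ => AffineMap.lineMap (k := ℝ) y z s)
      (fderiv ℝ g y (z - y)) 0 := by
    refine HasFDerivAt.comp_hasDerivAt (0 : ℝ) ?_ hline
    simpa using hd.hasFDerivAt
  have hconv : ConvexOn ℝ (AffineMap.lineMap (k := ℝ) y z ⁻¹' P)
      (g ∘ fun s : ℝ => AffineMap.lineMap (k := ℝ) y z s) :=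
    hg.comp_affineMap (AffineMap.lineMap (k := ℝ) y z)
  have h := hconv.le_slope_of_hasDerivAt (x := 0) (y := 1) (by simpa using hy) (by simpa using hz)
    one_pos hder
  rw [← neg_sub z y, inner_neg_right]
  rw [← InnerProductSpace.toDual_apply_apply, toDual_gradient]
  simp [slope_def_field] at h
  simp
  linarith

theorem norm_gradient_le {n : ℕ} {U : Set (EuclideanSpace ℝ (Fin n))}
    {g : EuclideanSpace ℝ (Fin n) → ℝ} {L : ℝ≥0} {x : EuclideanSpace ℝ (Fin n)}
    (hU : U ∈ nhds x) (hg : LipschitzOnWith L g U) : ‖gradient g x‖ ≤ L := by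
  rw [gradient, LinearIsometryEquiv.norm_map]
  exact norm_fderiv_le_of_lipschitzOn ℝ hU hg

theorem sum_le_of_hasCurvatureAtMost {n : ℕ} {P : Set (EuclideanSpace ℝ (Fin n))}
    {g : ℕ → EuclideanSpace ℝ (Fin n) → ℝ} {c : ℕ → ℝ} {s : Finset ℕ}
    (hc : ∀ i ∈ s, HasCurvatureAtMost P (g i) (c i)) {γ : ℝ} (hγ : γ ∈ Set.Icc (0 : ℝ) 1)
    {y z : EuclideanSpace ℝ (Fin n)} (hy : y ∈ P) (hz : z ∈ P) :
    ∑ i ∈ s, g i (γ • z + (1 - γ) • y) ≤ ∑ i ∈ s, g i y +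
      γ * inner ℝ (∑ i ∈ s, gradient (g i) y) (z - y) + (∑ i ∈ s, c i) * γ ^ 2 / 2 := by
  rw [sum_inner, Finset.mul_sum, Finset.sum_mul, Finset.sum_div, ← Finset.sum_add_distrib,
    ← Finset.sum_add_distrib]
  exact Finset.sum_le_sum fun i hi => (hc i hi).2 y hy z hz γ hγ

/-! ### Ball smoothing -/

/-- The uniform distribution on the Euclidean unit ball. -/
noncomputable def unitBallMeasure (n : ℕ) : Measure (EuclideanSpace ℝ (Fin n)) :=
  (volume.restrict (Metric.closedBall (0 : EuclideanSpace ℝ (Fin n)) 1) Set.univ)⁻¹ •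
    volume.restrict (Metric.closedBall (0 : EuclideanSpace ℝ (Fin n)) 1)

theorem smoothing_eq_integral {n : ℕ} (r : ℝ) (f : EuclideanSpace ℝ (Fin n) → ℝ)
    (x : EuclideanSpace ℝ (Fin n)) :
    smoothing r f x = ∫ u, f (x + r • u) ∂unitBallMeasure n := rfl

theorem volume_real_unitBall_pos (n : ℕ) :
    0 < volume.real (Metric.closedBall (0 : EuclideanSpace ℝ (Fin n)) 1) :=
  ENNReal.toReal_pos
    (Metric.measure_closedBall_pos volume _ one_pos).ne' measure_closedBall_lt_top.ne

instance isProbabilityMeasure_unitBallMeasure (n : ℕ) :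
    IsProbabilityMeasure (unitBallMeasure n) := by
  refine ⟨?_⟩
  rw [unitBallMeasure, Measure.smul_apply, smul_eq_mul, Measure.restrict_apply_univ]
  exact ENNReal.inv_mul_cancel (Metric.measure_closedBall_pos volume _ one_pos).ne'
    measure_closedBall_lt_top.ne

theorem unitBallMeasure_absolutelyContinuous (n : ℕ) : unitBallMeasure n ≪ volume :=
  Measure.smul_absolutelyContinuous.trans Measure.restrict_le_self.absolutelyContinuous

theorem ae_norm_le_one_unitBallMeasure (n : ℕ) : ∀ᵐ u ∂unitBallMeasure n, ‖u‖ ≤ 1 := by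
  have : ∀ᵐ u ∂volume.restrict (Metric.closedBall (0 : EuclideanSpace ℝ (Fin n)) 1), ‖u‖ ≤ 1 := by
    filter_upwards [ae_restrict_mem Metric.isClosed_closedBall.measurableSet] with u hu
    simpa using hu
  exact Measure.smul_absolutelyContinuous.ae_le this

/-- Lets Rademacher's theorem be applied at the random point x + r u. -/
theorem ae_comp_add_smul {n : ℕ} {p : EuclideanSpace ℝ (Fin n) → Prop}
    (hp : ∀ᵐ y, p y) (x : EuclideanSpace ℝ (Fin n)) {r : ℝ} (hr : r ≠ 0) :
    ∀ᵐ u ∂unitBallMeasure n, p (x + r • u) := by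
  refine (unitBallMeasure_absolutelyContinuous n).ae_le ?_
  change volume ((fun u => r • u) ⁻¹' ((fun y => x + y) ⁻¹' {y | ¬ p y})) = 0
  rw [Measure.addHaar_preimage_smul _ hr, measure_preimage_add, ae_iff.1 hp, mul_zero]

theorem integrable_comp_add_smul {n : ℕ} {L : ℝ≥0} {f : EuclideanSpace ℝ (Fin n) → ℝ}
    (hf : LipschitzWith L f) (x : EuclideanSpace ℝ (Fin n)) (r : ℝ) :
    Integrable (fun u => f (x + r • u)) (unitBallMeasure n) := by
  have hc : Continuous fun u => f (x + r • u) := hf.continuous.comp (by fun_prop)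
  refine Integrable.of_bound hc.aestronglyMeasurable (‖f x‖ + L * |r|) ?_
  filter_upwards [ae_norm_le_one_unitBallMeasure n] with u hu
  have h1 := hf.norm_sub_le (x + r • u) x
  rw [add_sub_cancel_left, norm_smul, Real.norm_eq_abs r] at h1
  have h2 : (L : ℝ) * (|r| * ‖u‖) ≤ L * |r| := by
    gcongr
    exact mul_le_of_le_one_right (abs_nonneg r) hu
  have h3 := norm_sub_norm_le (f (x + r • u)) (f x)
  linarith

theorem abs_smoothing_sub_le {n : ℕ} {L : ℝ≥0} {f : EuclideanSpace ℝ (Fin n) → ℝ}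
    (hf : LipschitzWith L f) (x : EuclideanSpace ℝ (Fin n)) {r : ℝ} (hr : 0 ≤ r) :
    |smoothing r f x - f x| ≤ L * r := by
  have h : smoothing r f x - f x = ∫ u, (f (x + r • u) - f x) ∂unitBallMeasure n := by
    rw [integral_sub (integrable_comp_add_smul hf x r) (integrable_const _), smoothing_eq_integral]
    simp
  rw [h, ← Real.norm_eq_abs]
  refine (norm_integral_le_of_norm_le_const (C := L * r) ?_).trans (by simp)
  filter_upwards [ae_norm_le_one_unitBallMeasure n] with u hu
  refine (hf.norm_sub_le _ _).trans ?_
  rw [add_sub_cancel_left, norm_smul, Real.norm_of_nonneg hr]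
  gcongr
  exact mul_le_of_le_one_right hr hu

theorem lipschitzWith_smoothing {n : ℕ} {L : ℝ≥0} {f : EuclideanSpace ℝ (Fin n) → ℝ}
    (hf : LipschitzWith L f) (r : ℝ) : LipschitzWith L (smoothing r f) := by
  refine LipschitzWith.of_dist_le_mul fun x y => ?_
  rw [smoothing_eq_integral, smoothing_eq_integral, dist_eq_norm,
    ← integral_sub (integrable_comp_add_smul hf x r) (integrable_comp_add_smul hf y r)]
  refine (norm_integral_le_of_norm_le_const (C := L * dist x y) ?_).trans (by simp)
  refine Filter.Eventually.of_forall fun u => ?_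
  simpa [dist_eq_norm] using hf.norm_sub_le (x + r • u) (y + r • u)

/-- Differentiation under the integral: by Rademacher's theorem the integrand is differentiable at x
for almost every u, and the Lipschitz constant dominates. -/
theorem hasFDerivAt_smoothing {n : ℕ} {L : ℝ≥0} {f : EuclideanSpace ℝ (Fin n) → ℝ}
    (hf : LipschitzWith L f) {r : ℝ} (hr : r ≠ 0) (x : EuclideanSpace ℝ (Fin n)) :
    HasFDerivAt (smoothing r f) (∫ u, fderiv ℝ f (x + r • u) ∂unitBallMeasure n) x := by
  have key := hasFDerivAt_integral_of_dominated_loc_of_lip (𝕜 := ℝ) (μ := unitBallMeasure n)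
    (F := fun x u => f (x + r • u)) (F' := fun u => fderiv ℝ f (x + r • u)) (x₀ := x)
    (bound := fun _ => (L : ℝ)) (s := Set.univ) Filter.univ_mem
    (Filter.Eventually.of_forall fun y => (integrable_comp_add_smul hf y r).1)
    (integrable_comp_add_smul hf x r)
    (((measurable_fderiv ℝ f).comp (by fun_prop)).aestronglyMeasurable)
    (Filter.Eventually.of_forall fun u => by
      rw [show Real.nnabs (L : ℝ) = L by simp, lipschitzOnWith_univ]
      refine LipschitzWith.of_dist_le_mul fun y z => ?_
      simpa [dist_eq_norm] using hf.norm_sub_le (y + r • u) (z + r • u))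
    (integrable_const _)
    (by
      filter_upwards [ae_comp_add_smul (hf.ae_differentiableAt (μ := volume)) x hr] with u hu
      have h1 := hu.hasFDerivAt
      rw [← hasFDerivAt_comp_add_right (r • u)] at h1
      exact h1)
  exact key.2

/-- A unit ball covers all but a fraction `n ‖a - b‖` of another unit ball. -/
theorem volume_real_closedBall_diff_le {n : ℕ} (a b : EuclideanSpace ℝ (Fin n)) :
    volume.real (Metric.closedBall a 1 \ Metric.closedBall b 1) ≤
      n * ‖a - b‖ * volume.real (Metric.closedBall (0 : EuclideanSpace ℝ (Fin n)) 1) := by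
  set V := volume.real (Metric.closedBall (0 : EuclideanSpace ℝ (Fin n)) 1) with hV
  have hV0 : 0 ≤ V := measureReal_nonneg
  have hball : ∀ (c : EuclideanSpace ℝ (Fin n)) (ρ : ℝ), 0 ≤ ρ →
      volume.real (Metric.closedBall c ρ) = ρ ^ n * V := fun c ρ hρ => by
    rw [Measure.addHaar_real_closedBall' _ _ hρ, finrank_euclideanSpace_fin]
  rcases Nat.eq_zero_or_pos n with rfl | hn
  · rw [Subsingleton.elim a b]
    simp
  rcases le_or_gt ‖a - b‖ 1 with hab | hab
  -- The ball of radius 1 - ‖a - b‖ around `a` lies in both unit balls; Bernoulli's inequality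
  -- bounds the volume outside it.
  · have hsub : Metric.closedBall a (1 - ‖a - b‖) ⊆ Metric.closedBall b 1 :=
      Metric.closedBall_subset_closedBall' (by rw [dist_eq_norm]; linarith)
    have hsub' : Metric.closedBall a (1 - ‖a - b‖) ⊆ Metric.closedBall a 1 :=
      Metric.closedBall_subset_closedBall (by linarith [norm_nonneg (a - b)])
    calc volume.real (Metric.closedBall a 1 \ Metric.closedBall b 1)
        ≤ volume.real (Metric.closedBall a 1 \ Metric.closedBall a (1 - ‖a - b‖)) :=
          measureReal_mono (Set.sdiff_subset_sdiff_right hsub)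
            ((measure_mono Set.sdiff_subset).trans_lt measure_closedBall_lt_top).ne
      _ = V - (1 - ‖a - b‖) ^ n * V := by
          rw [measureReal_sdiff hsub' Metric.isClosed_closedBall.measurableSet
            measure_closedBall_lt_top.ne, hball a 1 zero_le_one, hball a _ (by linarith), one_pow,
            one_mul]
      _ ≤ n * ‖a - b‖ * V := by
          have := one_add_mul_le_pow (a := -‖a - b‖) (by linarith) n
          rw [← sub_eq_add_neg] at this
          nlinarith [mul_le_mul_of_nonneg_right this hV0]
  · calc volume.real (Metric.closedBall a 1 \ Metric.closedBall b 1)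
        ≤ volume.real (Metric.closedBall a 1) :=
          measureReal_mono Set.sdiff_subset measure_closedBall_lt_top.ne
      _ = V := by rw [hball a 1 zero_le_one]; simp
      _ ≤ n * ‖a - b‖ * V := by
          have : (1 : ℝ) ≤ n := by exact_mod_cast hn
          exact le_mul_of_one_le_left hV0 (by nlinarith)

/-- Translation moves the second integral to the shifted ball. The integrals cancel on the
intersection, and each of the two remaining crescents has relative volume at most n ‖a‖. -/
theorem norm_integral_unitBallMeasure_sub_comp_add_le {n : ℕ} {F : Type*} [NormedAddCommGroup F]
    [NormedSpace ℝ F] {G : EuclideanSpace ℝ (Fin n) → F} (hG : AEStronglyMeasurable G) {L : ℝ}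
    (hL : ∀ u, ‖G u‖ ≤ L) (a : EuclideanSpace ℝ (Fin n)) :
    ‖∫ u, G u ∂unitBallMeasure n - ∫ u, G (u + a) ∂unitBallMeasure n‖ ≤ 2 * n * L * ‖a‖ := by
  set B := Metric.closedBall (0 : EuclideanSpace ℝ (Fin n)) 1 with hB
  set B' := Metric.closedBall a 1 with hB'
  have hBm : MeasurableSet B := Metric.isClosed_closedBall.measurableSet
  have hBm' : MeasurableSet B' := Metric.isClosed_closedBall.measurableSet
  have hV : 0 < volume.real B := volume_real_unitBall_pos n
  have hL0 : 0 ≤ L := (norm_nonneg _).trans (hL 0)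
  have hint : ∀ s : Set (EuclideanSpace ℝ (Fin n)), volume s < ∞ → IntegrableOn G s := fun s hs =>
    Measure.integrableOn_of_bounded hs.ne hG (M := L) (Filter.Eventually.of_forall hL)
  have hav : ∀ H : EuclideanSpace ℝ (Fin n) → F,
      ∫ u, H u ∂unitBallMeasure n = (volume.real B)⁻¹ • ∫ u in B, H u := fun H => by
    rw [unitBallMeasure, integral_smul_measure, Measure.restrict_apply_univ, ENNReal.toReal_inv]
    rfl
  have hshift : ∫ u in B, G (u + a) = ∫ u in B', G u := by
    have hpre : (fun u => u + a) ⁻¹' B' = B := by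
      ext u
      simp [hB, hB', dist_eq_norm]
    rw [← hpre]
    exact (measurePreserving_add_right volume a).setIntegral_preimage_emb
      (measurableEmbedding_addRight a) G B'
  have h1 := integral_inter_add_sdiff hBm' (hint B measure_closedBall_lt_top)
  have h2 := integral_inter_add_sdiff hBm (hint B' measure_closedBall_lt_top)
  rw [Set.inter_comm] at h2
  have hdiff : (∫ u in B, G u) - ∫ u in B', G u =
      (∫ u in B \ B', G u) - ∫ u in B' \ B, G u := by
    rw [← h1, ← h2]
    abel
  have hbound : ∀ c d : EuclideanSpace ℝ (Fin n), ‖c - d‖ = ‖a‖ →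
      ‖∫ u in Metric.closedBall c 1 \ Metric.closedBall d 1, G u‖ ≤
        L * (n * ‖a‖ * volume.real B) := fun c d hcd => by
    refine (norm_setIntegral_le_of_norm_le_const
      ((measure_mono Set.sdiff_subset).trans_lt measure_closedBall_lt_top) fun u _ => hL u).trans ?_
    gcongr
    rw [← hcd]
    exact volume_real_closedBall_diff_le c d
  rw [hav, hav, hshift, ← smul_sub, hdiff, norm_smul, Real.norm_of_nonneg (inv_nonneg.2 hV.le),
    inv_mul_le_iff₀ hV]
  refine (norm_sub_le _ _).trans ?_
  have e1 := hbound 0 a (by simp)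
  have e2 := hbound a 0 (by simp)
  calc _ ≤ L * (n * ‖a‖ * volume.real B) + L * (n * ‖a‖ * volume.real B) := add_le_add e1 e2
    _ = _ := by ring

theorem norm_fderiv_smoothing_sub_le {n : ℕ} {L : ℝ≥0} {f : EuclideanSpace ℝ (Fin n) → ℝ}
    (hf : LipschitzWith L f) {r : ℝ} (hr : 0 < r) (x y : EuclideanSpace ℝ (Fin n)) :
    ‖fderiv ℝ (smoothing r f) x - fderiv ℝ (smoothing r f) y‖ ≤ 2 * n * L / r * ‖x - y‖ := by
  rw [(hasFDerivAt_smoothing hf hr.ne' x).fderiv, (hasFDerivAt_smoothing hf hr.ne' y).fderiv]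
  have h := norm_integral_unitBallMeasure_sub_comp_add_le
    (G := fun u => fderiv ℝ f (x + r • u)) (L := L)
    (((measurable_fderiv ℝ f).comp (by fun_prop)).aestronglyMeasurable)
    (fun u => norm_fderiv_le_of_lipschitz ℝ hf) (r⁻¹ • (y - x))
  have he : ∀ u : EuclideanSpace ℝ (Fin n), x + r • (u + r⁻¹ • (y - x)) = y + r • u := fun u => by
    rw [smul_add, smul_inv_smul₀ hr.ne']
    abel
  simp only [he] at h
  refine h.trans_eq ?_
  rw [norm_smul, norm_sub_rev y x, norm_inv, Real.norm_of_nonneg hr.le]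
  ring

/-- The descent lemma, obtained by showing that the error along the segment minus its quadratic
bound is antitone. -/
theorem le_of_lipschitz_fderiv {E : Type*} [NormedAddCommGroup E] [NormedSpace ℝ E] {g : E → ℝ}
    {M : ℝ} (hd : Differentiable ℝ g) (hM : ∀ x y, ‖fderiv ℝ g x - fderiv ℝ g y‖ ≤ M * ‖x - y‖)
    (x d : E) : g (x + d) ≤ g x + fderiv ℝ g x d + M * ‖d‖ ^ 2 / 2 := by
  have hder : ∀ s : ℝ, HasDerivAt (fun s : ℝ => g (x + s • d) - s * fderiv ℝ g x d -
      M * ‖d‖ ^ 2 / 2 * s ^ 2)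
      (fderiv ℝ g (x + s • d) d - fderiv ℝ g x d - M * ‖d‖ ^ 2 * s) s := fun s => by
    have h1 : HasDerivAt (fun s : ℝ => x + s • d) d s := by
      simpa using ((hasDerivAt_id s).smul_const d).const_add x
    have h2 := ((hd (x + s • d)).hasFDerivAt.comp_hasDerivAt s h1).sub
      ((hasDerivAt_id s).mul_const (fderiv ℝ g x d))
    have h3 := h2.sub ((hasDerivAt_pow 2 s).const_mul (M * ‖d‖ ^ 2 / 2))
    refine h3.congr_deriv ?_
    simp
    ring
  have hanti : AntitoneOn (fun s : ℝ => g (x + s • d) - s * fderiv ℝ g x d -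
      M * ‖d‖ ^ 2 / 2 * s ^ 2) (Set.Icc 0 1) := by
    refine antitoneOn_of_deriv_nonpos (convex_Icc 0 1)
      (fun s _ => (hder s).continuousAt.continuousWithinAt)
      (fun s _ => (hder s).differentiableAt.differentiableWithinAt) fun s hs => ?_
    rw [interior_Icc] at hs
    rw [(hder s).deriv, ← sub_apply, sub_nonpos]
    refine (Real.le_norm_self _).trans ((ContinuousLinearMap.le_opNorm _ _).trans ?_)
    have := hM (x + s • d) x
    rw [add_sub_cancel_left, norm_smul, Real.norm_of_nonneg hs.1.le] at this
    nlinarith [mul_le_mul_of_nonneg_right this (norm_nonneg d)]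
  have := hanti (Set.left_mem_Icc.2 zero_le_one) (Set.right_mem_Icc.2 zero_le_one) zero_le_one
  simp at this
  linarith

theorem hasCurvatureAtMost_smoothing {n : ℕ} {P : Set (EuclideanSpace ℝ (Fin n))}
    (hP : Bornology.IsBounded P) {L : ℝ≥0} {f : EuclideanSpace ℝ (Fin n) → ℝ}
    (hf : LipschitzWith L f) {r : ℝ} (hr : 0 < r) :
    HasCurvatureAtMost P (smoothing r f) (2 * n * L / r * Metric.diam P ^ 2) := by
  refine ⟨fun x _ => (hasFDerivAt_smoothing hf hr.ne' x).differentiableAt,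
    fun x hx y hy γ hγ => ?_⟩
  have h := le_of_lipschitz_fderiv (fun x => (hasFDerivAt_smoothing hf hr.ne' x).differentiableAt)
    (norm_fderiv_smoothing_sub_le hf hr) x (γ • (y - x))
  have hxy : x + γ • (y - x) = γ • y + (1 - γ) • x := by
    rw [smul_sub, sub_smul, one_smul]
    abel
  rw [hxy, map_smul, smul_eq_mul, norm_smul, Real.norm_of_nonneg hγ.1, ← toDual_gradient,
    InnerProductSpace.toDual_apply_apply, mul_pow] at h
  refine h.trans ?_
  have hD : ‖y - x‖ ≤ Metric.diam P := by
    rw [← dist_eq_norm]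
    exact Metric.dist_le_diam_of_mem hP hy hx
  have : 2 * n * L / r * (γ ^ 2 * ‖y - x‖ ^ 2) ≤
      2 * n * L / r * Metric.diam P ^ 2 * γ ^ 2 := by
    rw [mul_assoc _ (Metric.diam P ^ 2), mul_comm (γ ^ 2)]
    gcongr
  linarith

theorem smoothing_eq_of_eqOn {n : ℕ} {r : ℝ} (hr : 0 ≤ r) {f g : EuclideanSpace ℝ (Fin n) → ℝ}
    {x : EuclideanSpace ℝ (Fin n)} (h : Set.EqOn f g (Metric.closedBall x r)) :
    smoothing r f x = smoothing r g x := by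
  rw [smoothing_eq_integral, smoothing_eq_integral]
  refine integral_congr_ae ?_
  filter_upwards [ae_norm_le_one_unitBallMeasure n] with u hu
  refine h ?_
  rw [Metric.mem_closedBall, dist_eq_norm, add_sub_cancel_left, norm_smul,
    Real.norm_of_nonneg hr]
  exact mul_le_of_le_one_right hr hu

/-- By compactness a neighbourhood of the closed ball stays in `U`. Agreement near x, and not only
at x, is what transfers gradients. -/
theorem smoothing_eventuallyEq_of_eqOn {n : ℕ} {r : ℝ} (hr : 0 ≤ r)
    {f g : EuclideanSpace ℝ (Fin n) → ℝ} {U : Set (EuclideanSpace ℝ (Fin n))} (hU : IsOpen U)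
    (h : Set.EqOn f g U) {x : EuclideanSpace ℝ (Fin n)} (hx : Metric.closedBall x r ⊆ U) :
    smoothing r f =ᶠ[nhds x] smoothing r g := by
  obtain ⟨ε, hε, hεU⟩ := (isCompact_closedBall x r).exists_thickening_subset_open hU hx
  filter_upwards [Metric.ball_mem_nhds x hε] with y hy
  refine smoothing_eq_of_eqOn hr fun z hz => h (hεU ?_)
  rw [Metric.mem_thickening_iff]
  refine ⟨z + (x - y), ?_, ?_⟩
  · simpa [dist_eq_norm, add_sub_assoc, ← sub_eq_add_neg] using hz
  · simpa [dist_eq_norm, norm_sub_rev] using hy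

theorem convexOn_smoothing {n : ℕ} {r : ℝ} (hr : 0 ≤ r) {L : ℝ≥0}
    {f : EuclideanSpace ℝ (Fin n) → ℝ} {U P : Set (EuclideanSpace ℝ (Fin n))}
    (hf : ConvexOn ℝ U f) (hL : LipschitzWith L f) (hP : Convex ℝ P)
    (hPU : ∀ x ∈ P, Metric.closedBall x r ⊆ U) : ConvexOn ℝ P (smoothing r f) := by
  refine ⟨hP, fun x hx y hy a b ha hb hab => ?_⟩
  simp only [smoothing_eq_integral, smul_eq_mul]
  rw [← integral_const_mul, ← integral_const_mul, ← integral_add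
    ((integrable_comp_add_smul hL x r).const_mul a) ((integrable_comp_add_smul hL y r).const_mul b)]
  refine integral_mono_ae (integrable_comp_add_smul hL _ r)
    (((integrable_comp_add_smul hL x r).const_mul a).add
      ((integrable_comp_add_smul hL y r).const_mul b)) ?_
  filter_upwards [ae_norm_le_one_unitBallMeasure n] with u hu
  have hmem : ∀ z ∈ P, z + r • u ∈ U := fun z hz => hPU z hz <| by
    rw [Metric.mem_closedBall, dist_eq_norm, add_sub_cancel_left, norm_smul,
      Real.norm_of_nonneg hr]
    exact mul_le_of_le_one_right hr hu
  have hab' : a • x + b • y + r • u = a • (x + r • u) + b • (y + r • u) := by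
    rw [smul_add, smul_add, add_add_add_comm, ← add_smul, hab, one_smul]
  change f (a • x + b • y + r • u) ≤ a * f (x + r • u) + b * f (y + r • u)
  rw [hab']
  exact hf.2 (hmem x hx) (hmem y hy) ha hb hab

/-- Smoothings of a convex Lipschitz function on an open set `U` around points whose
`r`-neighbourhoods lie in `U`. -/
theorem smoothing_properties {n : ℕ} {r : ℝ} (hr : 0 < r) {L : ℝ≥0}
    {f : EuclideanSpace ℝ (Fin n) → ℝ} {U P : Set (EuclideanSpace ℝ (Fin n))} (hU : IsOpen U)
    (hf : ConvexOn ℝ U f) (hL : LipschitzOnWith L f U) (hP : Convex ℝ P)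
    (hbd : Bornology.IsBounded P) (hPU : ∀ x ∈ P, Metric.closedBall x r ⊆ U) :
    HasCurvatureAtMost P (smoothing r f) (2 * n * L / r * Metric.diam P ^ 2) ∧
      ConvexOn ℝ P (smoothing r f) ∧ (∀ x ∈ P, ‖gradient (smoothing r f) x‖ ≤ L) ∧
      ∀ x ∈ P, |smoothing r f x - f x| ≤ L * r := by
  -- Nothing is known about `f` off `U`, not even measurability. A globally Lipschitz extension has
  -- the same smoothing near `P`; its convexity is used only on `U`.
  obtain ⟨g, hg, hfg⟩ := hL.extend_real
  have hev : ∀ x ∈ P, smoothing r f =ᶠ[nhds x] smoothing r g := fun x hx =>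
    smoothing_eventuallyEq_of_eqOn hr.le hU hfg (hPU x hx)
  have heq : Set.EqOn (smoothing r g) (smoothing r f) P := fun x hx => (hev x hx).eq_of_nhds.symm
  have hgrad : ∀ x ∈ P, gradient (smoothing r f) x = gradient (smoothing r g) x := fun x hx =>
    (hev x hx).gradient_eq
  refine ⟨⟨fun x hx => ?_, fun x hx y hy γ hγ => ?_⟩, ?_, fun x hx => ?_, fun x hx => ?_⟩
  · exact (hev x hx).differentiableAt_iff.2 (hasFDerivAt_smoothing hg hr.ne' x).differentiableAt
  · rw [← heq hx, ← heq (hP hy hx hγ.1 (sub_nonneg.2 hγ.2) (by ring)), hgrad x hx]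
    exact (hasCurvatureAtMost_smoothing hbd hg hr).2 x hx y hy γ hγ
  · exact (convexOn_smoothing hr.le (hf.congr hfg) hg hP hPU).congr heq
  · rw [hgrad x hx]
    exact norm_gradient_le Filter.univ_mem (lipschitzWith_smoothing hg r).lipschitzOnWith
  · rw [← heq hx, hfg (hPU x hx (Metric.mem_closedBall_self hr.le))]
    exact abs_smoothing_sub_le hg x hr.le

/-! ### Finite nets and uniform concentration -/

/-- A bounded set in `ℝⁿ` has a net of fineness `√n D / m` with `(2 m + 1) ^ n` points. -/
theorem exists_finite_net {n : ℕ} {P : Set (EuclideanSpace ℝ (Fin n))}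
    (hbd : Bornology.IsBounded P) (hD : 0 < Metric.diam P) {x₀ : EuclideanSpace ℝ (Fin n)}
    (hx₀ : x₀ ∈ P) {m : ℕ} (hm : 1 ≤ m) :
    ∃ p : (Fin n → Fin (2 * m + 1)) → EuclideanSpace ℝ (Fin n), (∀ j, p j ∈ P) ∧
      ∀ x ∈ P, ∃ j, ‖x - p j‖ ≤ √n * (Metric.diam P / m) := by
  classical
  set D := Metric.diam P with hDdef
  have hm0 : (0 : ℝ) < m := by exact_mod_cast hm
  have hc : ∀ x ∈ P, ∀ i, |x i - x₀ i| ≤ D := fun x hx i => by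
    have h1 := PiLp.norm_apply_le (x - x₀) i
    rw [← dist_eq_norm] at h1
    simpa using h1.trans (Metric.dist_le_diam_of_mem hbd hx hx₀)
  set q : EuclideanSpace ℝ (Fin n) → Fin n → ℝ := fun x i => (x i - x₀ i + D) * (m / D) with hq
  have hq0 : ∀ x ∈ P, ∀ i, 0 ≤ q x i := fun x hx i =>
    mul_nonneg (by linarith [neg_le_of_abs_le (hc x hx i)]) (by positivity)
  have hq1 : ∀ x ∈ P, ∀ i, ⌊q x i⌋₊ < 2 * m + 1 := fun x hx i => by
    rw [Nat.floor_lt (hq0 x hx i)]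
    have : q x i ≤ (2 * D) * (m / D) := by
      refine mul_le_mul_of_nonneg_right ?_ (by positivity)
      linarith [le_of_abs_le (hc x hx i)]
    have h2 : (2 * D) * (m / D) = 2 * m := by field_simp
    push_cast
    linarith
  -- The box of half-width D around x₀ is cut into cells of side D/m; the index 2m is reached only
  -- on the far faces. Each cell meeting `P` contributes one point of `P`, the others default to x₀.
  refine ⟨fun j => if h : ∃ y ∈ P, ∀ i, ⌊q y i⌋₊ = j i then h.choose else x₀, fun j => ?_,
    fun x hx => ⟨fun i => ⟨⌊q x i⌋₊, hq1 x hx i⟩, ?_⟩⟩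
  · dsimp only
    split_ifs with h
    · exact h.choose_spec.1
    · exact hx₀
  · have h : ∃ y ∈ P, ∀ i, ⌊q y i⌋₊ = ((⟨⌊q x i⌋₊, hq1 x hx i⟩ : Fin (2 * m + 1)) : ℕ) :=
      ⟨x, hx, fun i => rfl⟩
    beta_reduce
    rw [dif_pos h]
    obtain ⟨hy, hyi⟩ := h.choose_spec
    set y := h.choose
    have hcoord : ∀ i, ‖(x - y) i‖ ≤ D / m := fun i => by
      have e1 := Nat.floor_le (hq0 x hx i)
      have e2 := Nat.lt_floor_add_one (q x i)
      have e3 := Nat.floor_le (hq0 y hy i)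
      have e4 := Nat.lt_floor_add_one (q y i)
      rw [hyi i] at e3 e4
      have e5 : |q x i - q y i| ≤ 1 := abs_le.2 ⟨by linarith, by linarith⟩
      have e6 : q x i - q y i = (x i - y i) * (m / D) := by simp only [hq]; ring
      rw [e6, abs_mul, abs_of_pos (by positivity : 0 < (m : ℝ) / D), ← le_div_iff₀ (by positivity),
        one_div_div] at e5
      simpa using e5
    rw [EuclideanSpace.norm_eq]
    calc √(∑ i, ‖(x - y) i‖ ^ 2) ≤ √(∑ _i : Fin n, (D / m) ^ 2) :=
          Real.sqrt_le_sqrt (Finset.sum_le_sum fun i _ => by gcongr; exact hcoord i)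
      _ = √n * (D / m) := by
          rw [Finset.sum_const, Finset.card_univ, Fintype.card_fin, nsmul_eq_mul,
            Real.sqrt_mul (Nat.cast_nonneg n), Real.sqrt_sq (by positivity)]

theorem sum_Icc_one_eq_sum_range {M : Type*} [AddCommMonoid M] (F : ℕ → M) (t : ℕ) :
    ∑ i ∈ Finset.Icc 1 t, F i = ∑ i ∈ Finset.range t, F (i + 1) := by
  induction t with
  | zero => simp
  | succ t ih => rw [Finset.sum_Icc_succ_top (by omega), ih, Finset.sum_range_succ]

section Concentration

variable {n : ℕ} {Ω : Type*} [MeasurableSpace Ω] {μ : Measure Ω} [IsProbabilityMeasure μ]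
  {P U : Set (EuclideanSpace ℝ (Fin n))} {L : ℝ≥0}
  {f : ℕ → Ω → EuclideanSpace ℝ (Fin n) → ℝ} {fstar : EuclideanSpace ℝ (Fin n) → ℝ}

theorem IsIIDConvexLipschitz.abs_mean_sub_le (hf : IsIIDConvexLipschitz μ P U L f fstar)
    {x z : EuclideanSpace ℝ (Fin n)} (hx : x ∈ P) (hz : z ∈ P) :
    |fstar x - fstar z| ≤ L * ‖x - z‖ := by
  rw [← hf.mean 1 le_rfl x hx, ← hf.mean 1 le_rfl z hz,
    ← integral_sub (hf.integrable 1 le_rfl x hx) (hf.integrable 1 le_rfl z hz), ← Real.norm_eq_abs]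
  refine (norm_integral_le_of_norm_le_const (C := L * ‖x - z‖) ?_).trans (by simp)
  filter_upwards [hf.lipschitz 1 le_rfl] with ω hω
  exact hω.norm_sub_le (hf.subset hx) (hf.subset hz)

/-- Hoeffding's inequality. The values f_i(x) need not be bounded, but their differences lie in [-L
D, L D], which gives variance proxy (L D)². -/
theorem IsIIDConvexLipschitz.measureReal_sum_ge_le (hf : IsIIDConvexLipschitz μ P U L f fstar)
    (hbd : Bornology.IsBounded P) {x z : EuclideanSpace ℝ (Fin n)} (hx : x ∈ P) (hz : z ∈ P)
    (t : ℕ) {s : ℝ} (hs : 0 ≤ s) :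
    μ.real {ω | s ≤ ∑ i ∈ Finset.Icc 1 t, ((f i ω x - f i ω z) - (fstar x - fstar z))} ≤
      Real.exp (-s ^ 2 / (2 * t * (L * Metric.diam P) ^ 2)) := by
  have hind : iIndepFun (fun (i : ℕ) ω => (f (i + 1) ω x - f (i + 1) ω z) -
      (fstar x - fstar z)) μ :=
    hf.indep.comp (fun _ φ => (φ ⟨x, hx⟩ - φ ⟨z, hz⟩) - (fstar x - fstar z)) fun _ => by fun_prop
  have hsub : ∀ i < t, HasSubgaussianMGF (fun ω => (f (i + 1) ω x - f (i + 1) ω z) -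
      (fstar x - fstar z)) ((‖L * Metric.diam P - -(L * Metric.diam P)‖₊ / 2) ^ 2) μ := by
    intro i _
    have hix := hf.integrable (i + 1) (by omega) x hx
    have hiz := hf.integrable (i + 1) (by omega) z hz
    have hmean : ∫ ω, (f (i + 1) ω x - f (i + 1) ω z) ∂μ = fstar x - fstar z := by
      rw [integral_sub hix hiz, hf.mean _ (by omega) x hx, hf.mean _ (by omega) z hz]
    rw [← hmean]
    refine hasSubgaussianMGF_of_mem_Icc (hix.sub hiz).aestronglyMeasurable.aemeasurable ?_
    filter_upwards [hf.lipschitz (i + 1) (by omega)] with ω hω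
    refine abs_le.1 ((hω.norm_sub_le (hf.subset hx) (hf.subset hz)).trans ?_)
    gcongr
    rw [← dist_eq_norm]
    exact Metric.dist_le_diam_of_mem hbd hx hz
  have h := HasSubgaussianMGF.measure_sum_range_ge_le_of_iIndepFun hind hsub hs
  have hD : 0 ≤ L * Metric.diam P := mul_nonneg L.coe_nonneg Metric.diam_nonneg
  have hcoe : (((‖L * Metric.diam P - -(L * Metric.diam P)‖₊ / 2) ^ 2 : ℝ≥0) : ℝ) =
      (L * Metric.diam P) ^ 2 := by
    push_cast
    rw [sub_neg_eq_add, Real.norm_of_nonneg (by linarith)]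
    ring
  rw [hcoe] at h
  simpa only [sum_Icc_one_eq_sum_range] using h

/-- The bad set need not be measurable, so the complement of its measurable hull is taken. -/
theorem exists_measurableSet_of_bad_le {B : Set Ω} {δ : ℝ} (hδ : 0 ≤ δ)
    (hB : μ B ≤ ENNReal.ofReal δ) :
    ∃ G : Set Ω, MeasurableSet G ∧ ENNReal.ofReal (1 - δ) ≤ μ G ∧ Disjoint G B := by
  refine ⟨(toMeasurable μ B)ᶜ, (measurableSet_toMeasurable μ B).compl, ?_,
    Set.disjoint_compl_left_iff_subset.2 (subset_toMeasurable μ B)⟩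
  rw [prob_compl_eq_one_sub (measurableSet_toMeasurable μ B), measure_toMeasurable,
    ENNReal.ofReal_sub _ hδ, ENNReal.ofReal_one]
  exact tsub_le_tsub_left hB 1

/-- The union bound over T times and all pairs of net points. With R = n T²/δ, T ≤ δ Rⁿ and each net
has at most R^(2n) points, which explains the exponent 5n. -/
theorem card_mul_exp_le {T : ℕ} {δ : ℝ} (hn : 1 ≤ n) (hT : 2 ≤ T) (hδ : 0 < δ) (hδ1 : δ < 1) :
    (T : ℝ) * ((2 * (n * T) + 1 : ℝ) ^ n * (2 * (n * T) + 1 : ℝ) ^ n) *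
      Real.exp (-(5 * n * Real.log (n * (T : ℝ) ^ 2 / δ))) ≤ δ := by
  have hn' : (1 : ℝ) ≤ n := by exact_mod_cast hn
  have hT' : (2 : ℝ) ≤ T := by exact_mod_cast hT
  set R := n * (T : ℝ) ^ 2 / δ with hR
  have hnT : n * (T : ℝ) ^ 2 ≤ R := by
    rw [hR, le_div_iff₀ hδ]
    exact mul_le_of_le_one_right (by positivity) hδ1.le
  have hR0 : 0 < R := by positivity
  have h2 : (2 : ℝ) * (n * T) ≤ R := by nlinarith
  have h4 : (4 : ℝ) ≤ R := by nlinarith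
  have hexp : Real.exp (-(5 * n * Real.log R)) = (R ^ (5 * n))⁻¹ := by
    rw [Real.exp_neg, ← Real.exp_log (pow_pos hR0 (5 * n)), Real.log_pow]
    push_cast
    rfl
  have hTR : (T : ℝ) ≤ δ * R := by
    rw [hR, mul_div_cancel₀ _ hδ.ne']
    nlinarith
  have hRn : R ≤ R ^ n := le_self_pow₀ (by linarith) (by omega)
  have hb : (2 * (n * T) + 1 : ℝ) ^ n ≤ (R ^ 2) ^ n := by
    gcongr
    nlinarith
  rw [hexp, mul_inv_le_iff₀ (by positivity)]
  calc (T : ℝ) * ((2 * (n * T) + 1 : ℝ) ^ n * (2 * (n * T) + 1 : ℝ) ^ n)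
      ≤ (δ * R ^ n) * ((R ^ 2) ^ n * (R ^ 2) ^ n) := by
        gcongr
        exact hTR.trans (by gcongr)
    _ = δ * R ^ (5 * n) := by ring

/-- With probability at least `1 - δ`, the partial sums of the losses up to time `T` deviate from
their means uniformly on `P` by `O(L D √(n t log (n T² / δ)))`. -/
theorem IsIIDConvexLipschitz.exists_uniform_deviation
    (hf : IsIIDConvexLipschitz μ P U L f fstar) (hbd : Bornology.IsBounded P)
    (hn : 1 ≤ n) (hLD : 0 < L * Metric.diam P) {T : ℕ} (hT : 2 ≤ T) {δ : ℝ} (hδ : 0 < δ)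
    (hδ1 : δ < 1) {Q : ℕ → Ω → Prop} (hQ : ∀ t, 1 ≤ t → ∀ᵐ ω ∂μ, Q t ω) :
    ∃ G : Set Ω, MeasurableSet G ∧ ENNReal.ofReal (1 - δ) ≤ μ G ∧ ∀ ω ∈ G,
      (∀ t, 1 ≤ t → Q t ω) ∧ (∀ t, 1 ≤ t → ConvexOn ℝ U (f t ω)) ∧
      (∀ t, 1 ≤ t → LipschitzOnWith L (f t ω) U) ∧
      ∀ t, 1 ≤ t → t ≤ T → ∀ x ∈ P, ∀ z ∈ P, t * (fstar x - fstar z) ≤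
        ∑ i ∈ Finset.Icc 1 t, f i ω x - ∑ i ∈ Finset.Icc 1 t, f i ω z +
          L * Metric.diam P * (√(10 * n * Real.log (n * (T : ℝ) ^ 2 / δ)) * √t + 4) := by
  have hD : 0 < Metric.diam P := (pos_iff_pos_of_mul_pos hLD).1
    (lt_of_le_of_ne L.coe_nonneg fun h => by rw [← h, zero_mul] at hLD; exact hLD.false)
  obtain ⟨x₀, hx₀⟩ : P.Nonempty := by
    by_contra h
    rw [Set.not_nonempty_iff_eq_empty] at h
    simp [h] at hD
  have hn' : (1 : ℝ) ≤ n := by exact_mod_cast hn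
  have hT' : (2 : ℝ) ≤ T := by exact_mod_cast hT
  -- With m = n T the net has fineness at most D/T, so that approximation costs O(L D) over all T
  -- rounds.
  obtain ⟨p, hpP, hp⟩ := exists_finite_net hbd hD hx₀ (m := n * T)
    (Nat.one_le_iff_ne_zero.2 (by positivity))
  set D := Metric.diam P with hDdef
  set A := √(10 * n * Real.log (n * (T : ℝ) ^ 2 / δ)) with hA
  have hlog : 0 ≤ Real.log (n * (T : ℝ) ^ 2 / δ) := by
    refine Real.log_nonneg ((one_le_div hδ).2 ?_)
    nlinarith
  have hnet : ∀ x ∈ P, ∃ j, ‖x - p j‖ ≤ D / T := fun x hx => by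
    obtain ⟨j, hj⟩ := hp x hx
    refine ⟨j, hj.trans ?_⟩
    have hsq : √(n : ℝ) ≤ n := by
      rw [Real.sqrt_le_left (by linarith)]
      nlinarith
    calc √(n : ℝ) * (D / (n * T : ℕ)) ≤ n * (D / (n * T : ℕ)) := by gcongr
      _ = D / T := by
        push_cast
        field_simp
  set S : Fin T × (Fin n → Fin (2 * (n * T) + 1)) × (Fin n → Fin (2 * (n * T) + 1)) → Set Ω :=
    fun a => {ω | L * D * (A * √((a.1 + 1 : ℕ) : ℝ)) ≤
    ∑ i ∈ Finset.Icc 1 (a.1 + 1 : ℕ), ((f i ω (p a.2.1) - f i ω (p a.2.2)) -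
      (fstar (p a.2.1) - fstar (p a.2.2)))} with hS
  have hSμ : ∀ a, μ.real (S a) ≤ Real.exp (-(5 * n * Real.log (n * (T : ℝ) ^ 2 / δ))) := by
    intro a
    have h0 : 0 ≤ L * D * (A * √((a.1 + 1 : ℕ) : ℝ)) :=
      mul_nonneg hLD.le (mul_nonneg (Real.sqrt_nonneg _) (Real.sqrt_nonneg _))
    have h := hf.measureReal_sum_ge_le hbd (hpP a.2.1) (hpP a.2.2) (a.1 + 1 : ℕ) h0
    refine h.trans_eq ?_
    congr 1
    -- The 10 in `A` is twice the 5 of `card_mul_exp_le`, as Hoeffding's exponent carries the factor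
    -- 1/2.
    rw [← hDdef, mul_pow (L * D : ℝ), mul_pow A, Real.sq_sqrt (by positivity),
      Real.sq_sqrt (by positivity)]
    have hL : (L : ℝ) ≠ 0 := left_ne_zero_of_mul hLD.ne'
    field_simp
    ring
  have hunion : μ.real (⋃ a, S a) ≤ δ := by
    refine (measureReal_iUnion_fintype_le S).trans
      ((Finset.sum_le_sum fun a _ => hSμ a).trans ?_)
    have hcard : (Fintype.card
        (Fin T × (Fin n → Fin (2 * (n * T) + 1)) × (Fin n → Fin (2 * (n * T) + 1))) : ℝ) =
        T * ((2 * (n * T) + 1 : ℝ) ^ n * (2 * (n * T) + 1 : ℝ) ^ n) := by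
      simp
    rw [Finset.sum_const, Finset.card_univ, nsmul_eq_mul, hcard]
    exact card_mul_exp_le hn hT hδ hδ1
  have hae : ∀ᵐ ω ∂μ, ∀ t, 1 ≤ t → Q t ω ∧ ConvexOn ℝ U (f t ω) ∧ LipschitzOnWith L (f t ω) U := by
    rw [ae_all_iff]
    intro t
    by_cases ht : 1 ≤ t
    · filter_upwards [hQ t ht, hf.convex t ht, hf.lipschitz t ht] with ω h1 h2 h3 _
      exact ⟨h1, h2, h3⟩
    · exact Filter.Eventually.of_forall fun ω h => absurd h ht
  have hbad : μ ((⋃ a, S a) ∪ {ω | ¬ ∀ t, 1 ≤ t → Q t ω ∧ ConvexOn ℝ U (f t ω) ∧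
      LipschitzOnWith L (f t ω) U}) ≤ ENNReal.ofReal δ := by
    refine (measure_union_le _ _).trans ?_
    rw [ae_iff.1 hae, add_zero]
    exact (ENNReal.le_ofReal_iff_toReal_le (measure_ne_top μ _) hδ.le).2 hunion
  obtain ⟨G, hGm, hG, hdisj⟩ := exists_measurableSet_of_bad_le hδ.le hbad
  refine ⟨G, hGm, hG, fun ω hω => ?_⟩
  have hnot := Set.disjoint_left.1 hdisj hω
  rw [Set.mem_union, not_or, Set.mem_ofPred_eq, not_not, Set.mem_iUnion, not_exists] at hnot
  obtain ⟨hS', hgood⟩ := hnot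
  refine ⟨fun t ht => (hgood t ht).1, fun t ht => (hgood t ht).2.1, fun t ht => (hgood t ht).2.2,
    fun t ht htT x hx z hz => ?_⟩
  obtain ⟨j, hj⟩ := hnet z hz
  obtain ⟨l, hl⟩ := hnet x hx
  -- The pair is taken in the order (z, x): an upper deviation for z against x is a lower deviation
  -- for x against z.
  have hdev := hS' (⟨t - 1, by omega⟩, j, l)
  simp only [hS, Set.mem_ofPred_eq, not_le, Nat.sub_add_cancel ht] at hdev
  -- Four replacements by net points, of x and z in both f_i and f*, each costing L D/T.
  have hDT : ∀ i ∈ Finset.Icc 1 t, -(4 * (L * D / T)) ≤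
      ((f i ω x - f i ω z) - (fstar x - fstar z)) +
        ((f i ω (p j) - f i ω (p l)) - (fstar (p j) - fstar (p l))) := fun i hi => by
    have hlip := (hgood i (Finset.mem_Icc.1 hi).1).2.2
    have hLx : (L : ℝ) * ‖x - p l‖ ≤ L * D / T := by
      rw [mul_div_assoc]
      gcongr
    have hLz : (L : ℝ) * ‖z - p j‖ ≤ L * D / T := by
      rw [mul_div_assoc]
      gcongr
    have a1 := abs_le.1 ((hlip.norm_sub_le (hf.subset hx) (hf.subset (hpP l))).trans hLx)
    have a2 := abs_le.1 ((hlip.norm_sub_le (hf.subset hz) (hf.subset (hpP j))).trans hLz)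
    have a3 := abs_le.1 ((hf.abs_mean_sub_le hx (hpP l)).trans hLx)
    have a4 := abs_le.1 ((hf.abs_mean_sub_le hz (hpP j)).trans hLz)
    linarith [a1.1, a2.2, a3.2, a4.1]
  have hsum := Finset.card_nsmul_le_sum _ _ _ hDT
  rw [Finset.sum_add_distrib, nsmul_eq_mul, Nat.card_Icc, Nat.add_sub_cancel] at hsum
  have hx1 : ∑ i ∈ Finset.Icc 1 t, ((f i ω x - f i ω z) - (fstar x - fstar z)) =
      ∑ i ∈ Finset.Icc 1 t, f i ω x - ∑ i ∈ Finset.Icc 1 t, f i ω z - t * (fstar x - fstar z) := by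
    rw [Finset.sum_sub_distrib, Finset.sum_sub_distrib, Finset.sum_const, Nat.card_Icc,
      Nat.add_sub_cancel, nsmul_eq_mul]
  have htle : (t : ℝ) * (4 * (L * D / T)) ≤ 4 * (L * D) := by
    have : (t : ℝ) ≤ T := by exact_mod_cast htT
    calc (t : ℝ) * (4 * (L * D / T)) ≤ T * (4 * (L * D / T)) := by gcongr
      _ = 4 * (L * D) := by field_simp
  rw [hx1] at hsum
  linarith

end Concentration

/-! ### Summation over rounds and elementary estimates -/

theorem sum_one_div_sqrt_le (T : ℕ) : ∑ t ∈ Finset.Icc 1 T, √(t : ℝ) / t ≤ 2 * √(T : ℝ) := by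
  induction T with
  | zero => simp
  | succ T ih =>
    rw [Finset.sum_Icc_succ_top (by omega)]
    refine (add_le_add_left ih _).trans ?_
    have h0 : (0 : ℝ) ≤ T := Nat.cast_nonneg T
    push_cast
    set u := √(T : ℝ)
    set w := √((T : ℝ) + 1)
    have hu : u ^ 2 = T := Real.sq_sqrt h0
    have hw : w ^ 2 = T + 1 := Real.sq_sqrt (by positivity)
    have hu0 : 0 ≤ u := Real.sqrt_nonneg _
    have hw0 : 0 < w := Real.sqrt_pos.2 (by positivity)
    rw [← hw, pow_two, div_mul_cancel_left₀ hw0.ne', ← le_sub_iff_add_le', inv_le_iff_one_le_mul₀ hw0]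
    nlinarith [sq_nonneg (w - u)]

theorem sum_rpow_neg_one_third_le (T : ℕ) :
    ∑ t ∈ Finset.Icc 1 T, (t : ℝ) ^ (-(1 / 3) : ℝ) ≤ 3 / 2 * (T : ℝ) ^ (2 / 3 : ℝ) := by
  induction T with
  | zero => simp
  | succ T ih =>
    rw [Finset.sum_Icc_succ_top (by omega)]
    refine (add_le_add_left ih _).trans ?_
    have h0 : (0 : ℝ) ≤ T := Nat.cast_nonneg T
    push_cast
    have hcube : ∀ a : ℝ, 0 ≤ a → (a ^ (1 / 3 : ℝ)) ^ 3 = a := fun a ha => by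
      rw [← Real.rpow_natCast, ← Real.rpow_mul ha]
      norm_num
    have hsq : ∀ a : ℝ, 0 ≤ a → a ^ (2 / 3 : ℝ) = (a ^ (1 / 3 : ℝ)) ^ 2 := fun a ha => by
      rw [← Real.rpow_natCast, ← Real.rpow_mul ha]
      norm_num
    rw [hsq _ h0, hsq _ (by positivity), Real.rpow_neg (by positivity)]
    have hu := hcube T h0
    have hw := hcube (T + 1) (by positivity)
    have hu0 : 0 ≤ (T : ℝ) ^ (1 / 3 : ℝ) := by positivity
    have hw0 : 0 < ((T : ℝ) + 1) ^ (1 / 3 : ℝ) := by positivity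
    set u := (T : ℝ) ^ (1 / 3 : ℝ)
    set w := ((T : ℝ) + 1) ^ (1 / 3 : ℝ)
    have huw : u ≤ w := Real.rpow_le_rpow h0 (by linarith) (by norm_num)
    rw [← le_sub_iff_add_le', inv_le_iff_one_le_mul₀ hw0]
    have h1 : w ^ 3 - u ^ 3 = 1 := by linarith
    -- With 1 = w³ - u³, the goal 1 ≤ (3/2)(w² - u²) w is half of w³ - 3u²w + 2u³ ≥ 0, which factors
    -- in this way.
    have h2 : 0 ≤ (w - u) * ((w - u) * (w + 2 * u)) := by
      have := sub_nonneg.2 huw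
      positivity
    nlinarith

/-- Used with a_t the regret of round t and s_t = 1/γ_t; the additive 4 is absorbed into 4 √t. -/
theorem sum_le_of_mul_le {T : ℕ} {a s : ℕ → ℝ} {A B β S : ℝ} (hB : 0 ≤ B) (hA : 0 ≤ A)
    (hβ : 0 ≤ β)
    (ha : ∀ t, 1 ≤ t → t ≤ T → t * a t ≤ β * s t + B * (A * √(t : ℝ) + 4))
    (hS : ∑ t ∈ Finset.Icc 1 T, s t / t ≤ S) :
    ∑ t ∈ Finset.Icc 1 T, a t ≤ β * S + B * ((2 * A + 8) * √(T : ℝ)) := by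
  calc ∑ t ∈ Finset.Icc 1 T, a t
      ≤ ∑ t ∈ Finset.Icc 1 T, (β * (s t / t) + B * (A + 4) * (√(t : ℝ) / t)) := by
        refine Finset.sum_le_sum fun t ht => ?_
        obtain ⟨h1, h2⟩ := Finset.mem_Icc.1 ht
        have ht0 : (1 : ℝ) ≤ t := by exact_mod_cast h1
        have hsq : 1 ≤ √(t : ℝ) := Real.one_le_sqrt.2 ht0
        have h3 : β * (s t / t) + B * (A + 4) * (√(t : ℝ) / t) =
            (β * s t + B * (A * √(t : ℝ) + 4 * √(t : ℝ))) / t := by ring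
        rw [h3, le_div_iff₀ (by linarith), mul_comm]
        refine (ha t h1 h2).trans ?_
        gcongr
        linarith
    _ = β * ∑ t ∈ Finset.Icc 1 T, s t / t +
          B * (A + 4) * ∑ t ∈ Finset.Icc 1 T, √(t : ℝ) / t := by
        rw [Finset.sum_add_distrib, Finset.mul_sum, Finset.mul_sum]
    _ ≤ β * S + B * (A + 4) * (2 * √(T : ℝ)) := by
        gcongr
        exact sum_one_div_sqrt_le T
    _ = _ := by ring

theorem IsPolytope.convex {n : ℕ} {P : Set (EuclideanSpace ℝ (Fin n))} (hP : IsPolytope P) :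
    Convex ℝ P := by
  obtain ⟨-, m, A, a, rfl⟩ := hP
  intro x hx y hy s t hs ht hst i
  have h : ∑ j, A i j * (s • x + t • y) j = s * ∑ j, A i j * x j + t * ∑ j, A i j * y j := by
    rw [Finset.mul_sum, Finset.mul_sum, ← Finset.sum_add_distrib]
    refine Finset.sum_congr rfl fun j _ => ?_
    simp
    ring
  rw [h]
  calc s * ∑ j, A i j * x j + t * ∑ j, A i j * y j ≤ s * a i + t * a i := by
        gcongr
        exacts [hx i, hy i]
    _ = a i := by rw [← add_mul, hst, one_mul]

theorem IsPolytope.isCompact {n : ℕ} {P : Set (EuclideanSpace ℝ (Fin n))} (hP : IsPolytope P) :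
    IsCompact P := by
  refine Metric.isCompact_of_isClosed_isBounded ?_ hP.1
  obtain ⟨-, m, A, a, rfl⟩ := hP
  rw [Set.ofPred_forall]
  exact isClosed_iInter fun i => isClosed_le (by fun_prop) continuous_const

theorem HasCurvatureAtMost.nonneg {n : ℕ} {P : Set (EuclideanSpace ℝ (Fin n))}
    {g : EuclideanSpace ℝ (Fin n) → ℝ} {C : ℝ} (hg : HasCurvatureAtMost P g C)
    {x : EuclideanSpace ℝ (Fin n)} (hx : x ∈ P) : 0 ≤ C := by
  have h := hg.2 x hx x hx 1 (by simp)
  simp at h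
  linarith

theorem dist_le_sum_abs {n : ℕ} (y z : EuclideanSpace ℝ (Fin n)) :
    dist y z ≤ ∑ i, |y i - z i| := by
  rw [EuclideanSpace.dist_eq]
  refine Real.sqrt_le_iff.2 ⟨Finset.sum_nonneg fun i _ => abs_nonneg _, ?_⟩
  simp only [Real.dist_eq]
  exact Finset.sum_sq_le_sq_sum_of_nonneg fun i _ => abs_nonneg _

/-- The ℓ₁-diameter enters the regret bounds only through this comparison. -/
theorem diam_le_of_sum_abs_le {n : ℕ} {P : Set (EuclideanSpace ℝ (Fin n))} {k : ℝ}
    (hk : ∀ y ∈ P, ∀ z ∈ P, ∑ i, |y i - z i| ≤ k) {x : EuclideanSpace ℝ (Fin n)} (hx : x ∈ P) :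
    Metric.diam P ≤ k :=
  Metric.diam_le_of_forall_dist_le (by simpa using hk x hx x hx) fun y hy z hz =>
    (dist_le_sum_abs y z).trans (hk y hy z hz)

theorem IsLOCGRun.mem {n : ℕ} {P : Set (EuclideanSpace ℝ (Fin n))} {K C b S s : ℝ}
    {γ : ℕ → ℝ} {g : ℕ → EuclideanSpace ℝ (Fin n) → ℝ} {T : ℕ}
    {x : ℕ → EuclideanSpace ℝ (Fin n)} {h Φ : ℕ → ℝ}
    {v : ℕ → Option (EuclideanSpace ℝ (Fin n))} (run : IsLOCGRun P K C b S s γ g T x h Φ v)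
    (hP : Convex ℝ P) (hγ : ∀ t, 1 ≤ t → 0 < γ t ∧ γ t ≤ 1) {t : ℕ} (ht : 1 ≤ t) (htT : t ≤ T) :
    x t ∈ P := by
  induction t, ht using Nat.le_induction with
  | base => exact run.start.1
  | succ t ht ih =>
    have hx := ih (by omega)
    have hor := run.oracle t ht htT
    rcases hv : v t with _ | y
    · rw [(run.negative t ht htT hv).1]
      exact hx
    · rw [hv] at hor
      rw [(run.positive t ht htT y hv).1]
      exact hP hx hor.1.1 (by linarith [hγ t ht]) (hγ t ht).1.le (by ring)

section

variable {n : ℕ} {Ω : Type*} [MeasurableSpace Ω] {μ : Measure Ω} [IsProbabilityMeasure μ]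
  {P U : Set (EuclideanSpace ℝ (Fin n))} {L : ℝ≥0}
  {f : ℕ → Ω → EuclideanSpace ℝ (Fin n) → ℝ} {fstar : EuclideanSpace ℝ (Fin n) → ℝ}

theorem IsIIDConvexLipschitz.regretAtMost (hf : IsIIDConvexLipschitz μ P U L f fstar)
    (hP : IsCompact P) (hne : P.Nonempty) {T : ℕ} {x : ℕ → EuclideanSpace ℝ (Fin n)} {B : ℝ}
    (h : ∀ z ∈ P, ∑ t ∈ Finset.Icc 1 T, (fstar (x t) - fstar z) ≤ B) :
    RegretAtMost P fstar T x B := by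
  have hLip : LipschitzOnWith L fstar P := LipschitzOnWith.of_dist_le_mul fun x hx z hz => by
    simpa [dist_eq_norm] using hf.abs_mean_sub_le hx hz
  obtain ⟨y, hy, hmin⟩ := hP.exists_isMinOn hne hLip.continuousOn
  refine ⟨y, hy, isMinOn_iff.2 fun z hz => Finset.sum_le_sum fun _ _ => isMinOn_iff.1 hmin z hz, ?_⟩
  rw [← Finset.sum_sub_distrib]
  exact h y hy

theorem IsIIDConvexLipschitz.mean_sub_le (hf : IsIIDConvexLipschitz μ P U L f fstar)
    (hbd : Bornology.IsBounded P) {x z : EuclideanSpace ℝ (Fin n)} (hx : x ∈ P) (hz : z ∈ P) :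
    fstar x - fstar z ≤ L * Metric.diam P := by
  refine (le_of_abs_le (hf.abs_mean_sub_le hx hz)).trans ?_
  gcongr
  rw [← dist_eq_norm]
  exact Metric.dist_le_diam_of_mem hbd hx hz

end

/-- The argument does not produce the factor log T; for T ≥ 2 it is at least 0.69 and costs a
constant, 26 = 2·5 + 8·2. -/
theorem mul_sqrt_le_deviation {n T : ℕ} {δ : ℝ} (hn : 1 ≤ n) (hT : 2 ≤ T) (hδ : 0 < δ)
    (hδ1 : δ < 1) :
    (2 * √(10 * n * Real.log (n * (T : ℝ) ^ 2 / δ)) + 8) * √(T : ℝ) ≤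
      26 * √(n * T * Real.log (n * (T : ℝ) ^ 2 / δ) * Real.log T) := by
  have hn' : (1 : ℝ) ≤ n := by exact_mod_cast hn
  have hT' : (2 : ℝ) ≤ T := by exact_mod_cast hT
  have hl2 := Real.log_two_gt_d9
  have hlT : 0.69 ≤ Real.log T := by
    have := Real.log_le_log (by norm_num) hT'
    linarith
  have hR : (T : ℝ) ≤ n * (T : ℝ) ^ 2 / δ := by
    rw [le_div_iff₀ hδ]
    nlinarith
  set M := Real.log (n * (T : ℝ) ^ 2 / δ) with hM
  have hM1 : 0.69 ≤ M := hlT.trans (Real.log_le_log (by linarith) hR)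
  have hW0 : 0 ≤ √(n * T * M * Real.log T) := Real.sqrt_nonneg _
  have e1 : √(10 * n * M) * √(T : ℝ) ≤ 5 * √(n * T * M * Real.log T) := by
    rw [← Real.sqrt_mul (by positivity)]
    refine Real.sqrt_le_iff.2 ⟨by positivity, ?_⟩
    rw [mul_pow, Real.sq_sqrt (by positivity)]
    have : 0 ≤ n * T * M := by positivity
    nlinarith
  have e2 : √(T : ℝ) ≤ 2 * √(n * T * M * Real.log T) := by
    refine Real.sqrt_le_iff.2 ⟨by positivity, ?_⟩
    rw [mul_pow, Real.sq_sqrt (by positivity)]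
    have h1 : (0.69 : ℝ) * 0.69 ≤ M * Real.log T := by gcongr
    have h2 : (T : ℝ) * (0.69 * 0.69) ≤ n * T * (M * Real.log T) := by
      gcongr
      nlinarith
    nlinarith
  nlinarith

theorem rpow_neg_stepsize {t : ℕ} (ht : 1 ≤ t) {a : ℝ} (ha : 0 ≤ a) :
    (0 < (t : ℝ) ^ (-a) ∧ (t : ℝ) ^ (-a) ≤ 1) ∧ ((t + 1 : ℕ) : ℝ) ^ (-a) ≤ (t : ℝ) ^ (-a) := by
  have ht' : (1 : ℝ) ≤ t := by exact_mod_cast ht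
  refine ⟨⟨by positivity, Real.rpow_le_one_of_one_le_of_nonpos ht' (by linarith)⟩, ?_⟩
  exact Real.rpow_le_rpow_of_nonpos (by linarith) (by push_cast; linarith) (by linarith)

/-- The exponent keeps the shape 1 - b of `oracleValue`; the step sizes are chosen to make the
curvature error constant in t. -/
theorem mul_rpow_neg_half_sq {t : ℕ} (ht : 1 ≤ t) :
    (t : ℝ) ^ (1 - 0 : ℝ) * ((t : ℝ) ^ (-(1 / 2) : ℝ)) ^ 2 = 1 := by
  have ht' : (0 : ℝ) < t := by exact_mod_cast ht
  rw [← Real.rpow_natCast, ← Real.rpow_mul ht'.le, ← Real.rpow_add ht']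
  norm_num

theorem mul_rpow_neg_two_thirds_sq {t : ℕ} (ht : 1 ≤ t) :
    (t : ℝ) ^ (1 - -(1 / 3) : ℝ) * ((t : ℝ) ^ (-(2 / 3) : ℝ)) ^ 2 = 1 := by
  have ht' : (0 : ℝ) < t := by exact_mod_cast ht
  rw [← Real.rpow_natCast, ← Real.rpow_mul ht'.le, ← Real.rpow_add ht']
  norm_num

theorem sum_rpow_one_third_le (t : ℕ) :
    ∑ i ∈ Finset.Icc 1 t, (i : ℝ) ^ (1 / 3 : ℝ) ≤ (t : ℝ) ^ (1 - -(1 / 3) : ℝ) := by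
  rcases Nat.eq_zero_or_pos t with rfl | ht
  · simp
    positivity
  have ht' : (0 : ℝ) < t := by exact_mod_cast ht
  calc ∑ i ∈ Finset.Icc 1 t, (i : ℝ) ^ (1 / 3 : ℝ)
      ≤ ∑ _i ∈ Finset.Icc 1 t, (t : ℝ) ^ (1 / 3 : ℝ) := by
        refine Finset.sum_le_sum fun i hi => ?_
        have : (i : ℝ) ≤ t := by exact_mod_cast (Finset.mem_Icc.1 hi).2
        gcongr
    _ = (t : ℝ) ^ (1 - -(1 / 3) : ℝ) := by
        rw [Finset.sum_const, Nat.card_Icc, Nat.add_sub_cancel, nsmul_eq_mul, sub_neg_eq_add,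
          Real.rpow_add ht', Real.rpow_one]

/-! ### Observed regret for the two step-size schedules -/

/-- Regret of the algorithm on losses of curvature at most `C` that have been observed so far. -/
theorem IsLOCGRun.sum_sub_sum_le_of_curvature {n : ℕ} {P : Set (EuclideanSpace ℝ (Fin n))}
    {K C : ℝ} {L : ℝ≥0} {g : ℕ → EuclideanSpace ℝ (Fin n) → ℝ} {T : ℕ}
    {x : ℕ → EuclideanSpace ℝ (Fin n)} {h Φ : ℕ → ℝ} {v : ℕ → Option (EuclideanSpace ℝ (Fin n))}
    (run : IsLOCGRun P K C 0 0 0 (fun t => (t : ℝ) ^ (-(1 / 2) : ℝ)) g T x h Φ v)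
    (hP : Convex ℝ P) (hbd : Bornology.IsBounded P) (hK : 1 ≤ K)
    (hcv : ∀ t, 1 ≤ t → ConvexOn ℝ P (g t))
    (hgrad : ∀ t, 1 ≤ t → ∀ y ∈ P, ‖gradient (g t) y‖ ≤ L)
    (hcurv : ∀ t, 1 ≤ t → HasCurvatureAtMost P (g t) C)
    {t : ℕ} (ht : 1 ≤ t) (htT : t ≤ T) {z : EuclideanSpace ℝ (Fin n)} (hz : z ∈ P) :
    ∑ i ∈ Finset.Icc 1 t, g i (x t) - ∑ i ∈ Finset.Icc 1 t, g i z ≤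
      K * (C / 2 + 2 * (L * Metric.diam P)) * √(t : ℝ) := by
  have hC := (hcurv 1 le_rfl).nonneg run.start.1
  have key := run.sum_sub_sum_le (e := C / 2) (G := L) hP hbd hK (by linarith) L.coe_nonneg
    (fun t ht => (rpow_neg_stepsize ht (by norm_num)).1)
    (fun t ht => (rpow_neg_stepsize ht (by norm_num)).2)
    (fun t ht y hy z hz => convexOn_sub_le_inner_gradient (hcv t ht) hy hz ((hcurv t ht).1 y hy))
    hgrad
    (fun t ht => by rw [mul_assoc C, mul_rpow_neg_half_sq ht]; norm_num)
    (fun t ht y hy z hz => by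
      have hγ := (rpow_neg_stepsize ht (a := 1 / 2) (by norm_num)).1
      refine (sum_le_of_hasCurvatureAtMost (c := fun _ => C)
        (fun i hi => hcurv i (Finset.mem_Icc.1 hi).1) ⟨hγ.1.le, hγ.2⟩ hy hz).trans_eq ?_
      rw [Finset.sum_const, Nat.card_Icc, Nat.add_sub_cancel, nsmul_eq_mul, sub_zero, mul_one,
        Real.rpow_one, mul_comm C])
    t ht htT
  refine (key.2 z hz).trans_eq ?_
  rw [Real.rpow_neg (Nat.cast_nonneg t), div_inv_eq_mul, Real.sqrt_eq_rpow]

/-- Regret of the algorithm on the smoothings of the losses that have been observed so far. -/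
theorem IsLOCGRun.sum_sub_sum_le_of_smoothing {n : ℕ} {P U : Set (EuclideanSpace ℝ (Fin n))}
    {K : ℝ} {L : ℝ≥0} {g : ℕ → EuclideanSpace ℝ (Fin n) → ℝ} {T : ℕ}
    {x : ℕ → EuclideanSpace ℝ (Fin n)} {h Φ : ℕ → ℝ} {v : ℕ → Option (EuclideanSpace ℝ (Fin n))}
    (run : IsLOCGRun P K (4 * √(n : ℝ) * L * Metric.diam P) (-(1 / 3)) 0 0
      (fun t => (t : ℝ) ^ (-(2 / 3) : ℝ))
      (fun t => smoothing (√(n : ℝ) * Metric.diam P * (t : ℝ) ^ (-(1 / 3) : ℝ)) (g t)) T x h Φ v)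
    (hP : Convex ℝ P) (hbd : Bornology.IsBounded P) (hK : 1 ≤ K) (hn : 1 ≤ n)
    (hD : 0 < Metric.diam P) (hU : IsOpen U)
    (hPU : ∀ x ∈ P, Metric.closedBall x (√(n : ℝ) * Metric.diam P) ⊆ U)
    (hcv : ∀ t, 1 ≤ t → ConvexOn ℝ U (g t)) (hLip : ∀ t, 1 ≤ t → LipschitzOnWith L (g t) U)
    {t : ℕ} (ht : 1 ≤ t) (htT : t ≤ T) {z : EuclideanSpace ℝ (Fin n)} (hz : z ∈ P) :
    ∑ i ∈ Finset.Icc 1 t, g i (x t) - ∑ i ∈ Finset.Icc 1 t, g i z ≤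
      (4 * K + 3) * (√(n : ℝ) * L * Metric.diam P) * (t : ℝ) ^ (2 / 3 : ℝ) := by
  set D := Metric.diam P with hDdef
  have hn' : (1 : ℝ) ≤ n := by exact_mod_cast hn
  have hsn : 1 ≤ √(n : ℝ) := Real.one_le_sqrt.2 hn'
  have hnn : √(n : ℝ) ^ 2 = n := Real.sq_sqrt (by linarith)
  have hL : (0 : ℝ) ≤ L := L.coe_nonneg
  set r : ℕ → ℝ := fun t => √(n : ℝ) * D * (t : ℝ) ^ (-(1 / 3) : ℝ) with hr
  have hprop : ∀ t, 1 ≤ t → _ := fun t ht => by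
    have ht' := (rpow_neg_stepsize ht (a := 1 / 3) (by norm_num)).1
    have hr0 : 0 < r t := mul_pos (by positivity) ht'.1
    exact smoothing_properties hr0 hU (hcv t ht) (hLip t ht) hP hbd fun y hy =>
      (Metric.closedBall_subset_closedBall
        (mul_le_of_le_one_right (by positivity) ht'.2)).trans (hPU y hy)
  have hcoef : ∀ i : ℕ, 1 ≤ i →
      2 * n * L / r i * D ^ 2 = 2 * (√(n : ℝ) * L * D) * (i : ℝ) ^ (1 / 3 : ℝ) := fun i hi => by
    have hi' : (0 : ℝ) < i := by exact_mod_cast hi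
    have : 0 < (i : ℝ) ^ (1 / 3 : ℝ) := by positivity
    simp only [hr]
    rw [Real.rpow_neg hi'.le]
    nth_rewrite 1 [← hnn]
    field_simp
  -- With C = 4 √n L D and b = -1/3, C/(2 (1 - b)) = 3 C/8 = (3/2) √n L D. The smoothings only need
  -- √n L D, so there is room.
  have key := run.sum_sub_sum_le (e := 3 / 2 * (√(n : ℝ) * L * D)) (G := L) hP hbd hK
    (by positivity) L.coe_nonneg
    (fun t ht => (rpow_neg_stepsize ht (by norm_num)).1)
    (fun t ht => (rpow_neg_stepsize ht (by norm_num)).2)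
    (fun t ht y hy z hz => convexOn_sub_le_inner_gradient (hprop t ht).2.1 hy hz
      ((hprop t ht).1.1 y hy))
    (fun t ht => (hprop t ht).2.2.1)
    (fun t ht => by
      rw [mul_assoc (4 * √(n : ℝ) * L * D), mul_rpow_neg_two_thirds_sq ht]
      apply le_of_eq
      ring)
    (fun t ht y hy z hz => by
      have hγ := (rpow_neg_stepsize ht (a := 2 / 3) (by norm_num)).1
      refine (sum_le_of_hasCurvatureAtMost (c := fun i => 2 * n * L / r i * D ^ 2)
        (fun i hi => (hprop i (Finset.mem_Icc.1 hi).1).1) ⟨hγ.1.le, hγ.2⟩ hy hz).trans ?_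
      refine add_le_add le_rfl ?_
      rw [Finset.sum_congr rfl fun i hi => hcoef i (Finset.mem_Icc.1 hi).1, ← Finset.mul_sum]
      have h1 : 2 * (√(n : ℝ) * L * D) * ∑ i ∈ Finset.Icc 1 t, (i : ℝ) ^ (1 / 3 : ℝ) ≤
          2 * (√(n : ℝ) * L * D) * (t : ℝ) ^ (1 - -(1 / 3) : ℝ) := by
        gcongr
        exact sum_rpow_one_third_le t
      have h2 : 0 ≤ √(n : ℝ) * L * D * (t : ℝ) ^ (1 - -(1 / 3) : ℝ) := by positivity
      calc _ ≤ 2 * (√(n : ℝ) * L * D) * (t : ℝ) ^ (1 - -(1 / 3) : ℝ) *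
            ((t : ℝ) ^ (-(2 / 3) : ℝ)) ^ 2 / 2 := by gcongr
        _ = √(n : ℝ) * L * D * (t : ℝ) ^ (1 - -(1 / 3) : ℝ) *
            ((t : ℝ) ^ (-(2 / 3) : ℝ)) ^ 2 := by ring
        _ ≤ 3 / 2 * (√(n : ℝ) * L * D * (t : ℝ) ^ (1 - -(1 / 3) : ℝ) *
            ((t : ℝ) ^ (-(2 / 3) : ℝ)) ^ 2) := by
          have : 0 ≤ √(n : ℝ) * L * D * (t : ℝ) ^ (1 - -(1 / 3) : ℝ) *
            ((t : ℝ) ^ (-(2 / 3) : ℝ)) ^ 2 := by positivity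
          linarith
        _ = _ := by ring)
    t ht htT
  obtain ⟨hx, hreg⟩ := key
  -- Returning to the original losses costs L ∑ r_i, once at x_t and once at z; together these give
  -- the 3 in 4K + 3.
  have hclose : ∀ y ∈ P, |∑ i ∈ Finset.Icc 1 t, smoothing (r i) (g i) y -
      ∑ i ∈ Finset.Icc 1 t, g i y| ≤ L * (√(n : ℝ) * D) * (3 / 2 * (t : ℝ) ^ (2 / 3 : ℝ)) := by
    intro y hy
    rw [← Finset.sum_sub_distrib]
    refine (Finset.abs_sum_le_sum_abs _ _).trans ?_
    calc _ ≤ ∑ i ∈ Finset.Icc 1 t, L * (√(n : ℝ) * D) * (i : ℝ) ^ (-(1 / 3) : ℝ) :=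
          Finset.sum_le_sum fun i hi =>
            ((hprop i (Finset.mem_Icc.1 hi).1).2.2.2 y hy).trans_eq (by simp only [hr]; ring)
      _ ≤ _ := by
          rw [← Finset.mul_sum]
          gcongr
          exact sum_rpow_neg_one_third_le t
  have h1 := hreg z hz
  rw [Real.rpow_neg (Nat.cast_nonneg t), div_inv_eq_mul, ← hDdef] at h1
  have h2 := abs_le.1 (hclose _ hx)
  have h3 := abs_le.1 (hclose z hz)
  have h4 : K * (3 / 2 * (√(n : ℝ) * L * D) + 2 * (L * D)) * (t : ℝ) ^ (2 / 3 : ℝ) ≤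
      4 * K * (√(n : ℝ) * L * D) * (t : ℝ) ^ (2 / 3 : ℝ) := by
    gcongr ?_ * _
    have h5 : L * D ≤ √(n : ℝ) * L * D := by
      rw [mul_assoc]
      exact le_mul_of_one_le_left (by positivity) hsn
    have h6 : 0 ≤ √(n : ℝ) * L * D := by positivity
    nlinarith
  linarith [h2.1, h3.2]

/-! ### Assembling the regret events -/

section

variable {n : ℕ} {Ω : Type*} [MeasurableSpace Ω] {μ : Measure Ω} [IsProbabilityMeasure μ]
  {P U : Set (EuclideanSpace ℝ (Fin n))} {L : ℝ≥0}
  {f : ℕ → Ω → EuclideanSpace ℝ (Fin n) → ℝ} {fstar : EuclideanSpace ℝ (Fin n) → ℝ}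

theorem IsIIDConvexLipschitz.regretAtMost_of_mul_diam_eq_zero
    (hf : IsIIDConvexLipschitz μ P U L f fstar) (hP : IsCompact P)
    (hLD : L * Metric.diam P = 0) {T : ℕ} {x : ℕ → EuclideanSpace ℝ (Fin n)} (hne : P.Nonempty)
    (hx : ∀ t, 1 ≤ t → t ≤ T → x t ∈ P) {B : ℝ} (hB : 0 ≤ B) : RegretAtMost P fstar T x B := by
  refine hf.regretAtMost hP hne fun z hz => (Finset.sum_nonpos fun t ht => ?_).trans hB
  exact hLD ▸ hf.mean_sub_le hP.isBounded (hx t (Finset.mem_Icc.1 ht).1 (Finset.mem_Icc.1 ht).2) hz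

theorem one_le_dim_of_diam_pos (hD : 0 < Metric.diam P) : 1 ≤ n := by
  rcases Nat.eq_zero_or_pos n with rfl | hn
  · rw [Metric.diam_subsingleton Set.subsingleton_of_subsingleton] at hD
    exact absurd hD (lt_irrefl 0)
  · exact hn

theorem exists_regret_event_of_curvature {K : ℝ} (hK : 1 ≤ K) {k δ : ℝ} (hP : IsPolytope P)
    (hk : ∀ y ∈ P, ∀ z ∈ P, ∑ i, |y i - z i| ≤ k)
    (hf : IsIIDConvexLipschitz μ P U L f fstar) (hδ : 0 < δ) {C : ℝ}
    (hC : ∀ t, 1 ≤ t → ∀ᵐ ω ∂μ, HasCurvatureAtMost P (f t ω) C) {T : ℕ} (hT : 2 ≤ T) :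
    ∃ G : Set Ω, MeasurableSet G ∧ ENNReal.ofReal (1 - δ) ≤ μ G ∧ ∀ ω ∈ G, ∀ x h Φ v,
      IsLOCGRun P K C 0 0 0 (fun t => (t : ℝ) ^ (-(1 / 2) : ℝ)) (fun t => f t ω) T x h Φ v →
      RegretAtMost P fstar T x (39 * K * (C * √(T : ℝ) +
        L * k * √(n * T * Real.log (n * (T : ℝ) ^ 2 / δ) * Real.log T))) := by
  have hcomp := hP.isCompact
  have hW := Real.sqrt_nonneg (n * T * Real.log (n * (T : ℝ) ^ 2 / δ) * Real.log T)
  rcases le_or_gt 1 δ with hδ1 | hδ1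
  · exact ⟨∅, MeasurableSet.empty, by simp [ENNReal.ofReal_eq_zero.2 (sub_nonpos.2 hδ1)],
      fun ω hω => absurd hω (Set.notMem_empty ω)⟩
  -- If L D = 0 then f* is constant on `P`; otherwise D > 0 forces n ≥ 1, and the net and the tail
  -- bound are available.
  rcases (mul_nonneg L.coe_nonneg (Metric.diam_nonneg (s := P))).eq_or_lt with hLD | hLD
  · refine ⟨Set.univ, MeasurableSet.univ, by simp [hδ.le], fun ω _ x h Φ v run => ?_⟩
    have hx1 := run.start.1
    obtain ⟨ω', hω'⟩ := (hC 1 le_rfl).exists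
    have hC0 := hω'.nonneg hx1
    have hk0 := Metric.diam_nonneg.trans (diam_le_of_sum_abs_le hk hx1)
    exact hf.regretAtMost_of_mul_diam_eq_zero hcomp hLD.symm ⟨_, hx1⟩
      (fun t ht htT => run.mem hP.convex (fun t ht => (rpow_neg_stepsize ht (by norm_num)).1) ht htT)
      (by positivity)
  have hn : 1 ≤ n := one_le_dim_of_diam_pos (pos_of_mul_pos_right hLD L.coe_nonneg)
  obtain ⟨G, hGm, hG, hdev⟩ := hf.exists_uniform_deviation hP.1 hn hLD hT hδ hδ1 hC
  refine ⟨G, hGm, hG, fun ω hω x h Φ v run => ?_⟩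
  obtain ⟨hcurv, hcv, hLip, hdev⟩ := hdev ω hω
  have hx1 := run.start.1
  have hC0 := (hcurv 1 le_rfl).nonneg hx1
  have hDk := diam_le_of_sum_abs_le hk hx1
  refine hf.regretAtMost hcomp ⟨_, hx1⟩ fun z hz => ?_
  refine (sum_le_of_mul_le (s := fun t => √(t : ℝ)) hLD.le
    (Real.sqrt_nonneg (10 * n * Real.log (n * (T : ℝ) ^ 2 / δ)))
    (β := K * (C / 2 + 2 * (L * Metric.diam P))) (by positivity) (fun t ht htT => ?_)
    (sum_one_div_sqrt_le T)).trans ?_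
  · have hx := run.mem hP.convex (fun t ht => (rpow_neg_stepsize ht (by norm_num)).1) ht htT
    have hreg := run.sum_sub_sum_le_of_curvature hP.convex hP.1 hK
      (fun t ht => (hcv t ht).subset hf.subset hP.convex)
      (fun t ht y hy => norm_gradient_le (hf.isOpen.mem_nhds (hf.subset hy)) (hLip t ht))
      hcurv ht htT hz
    exact (hdev t ht htT _ hx z hz).trans (by gcongr)
  · have hb := mul_sqrt_le_deviation hn hT hδ hδ1
    set W := √(n * T * Real.log (n * (T : ℝ) ^ 2 / δ) * Real.log T)
    have hsT := Real.sqrt_nonneg (T : ℝ)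
    have hsW : √(T : ℝ) * 8 ≤ 26 * W := by
      refine le_trans ?_ hb
      have := Real.sqrt_nonneg (10 * n * Real.log (n * (T : ℝ) ^ 2 / δ))
      nlinarith
    set D := Metric.diam P
    have hkW : L * D * W ≤ L * k * W := by gcongr
    have hLDW : 0 ≤ L * D * W := mul_nonneg hLD.le hW
    have h1 := mul_le_mul_of_nonneg_left hb hLD.le
    have h2 := mul_le_mul_of_nonneg_left hsW hLD.le
    have h3 : 0 ≤ C * √(T : ℝ) := by positivity
    have hK0 : 0 ≤ K := by linarith
    have h4 := mul_le_mul_of_nonneg_left h2 hK0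
    -- Here 4 √T ≤ 13 W, the deviation gives 26 W, and 13K + 26 ≤ 39K as K ≥ 1.
    calc K * (C / 2 + 2 * (L * D)) * (2 * √(T : ℝ)) + _
        ≤ K * (C * √(T : ℝ)) + (13 * K + 26) * (L * D * W) := by linarith
      _ ≤ 39 * K * (C * √(T : ℝ)) + 39 * K * (L * D * W) := by gcongr <;> linarith
      _ ≤ 39 * K * (C * √(T : ℝ)) + 39 * K * (L * k * W) := by gcongr
      _ = _ := by ring

theorem exists_regret_event_of_smoothing {K : ℝ} (hK : 1 ≤ K) {k δ : ℝ} (hP : IsPolytope P)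
    (hk : ∀ y ∈ P, ∀ z ∈ P, ∑ i, |y i - z i| ≤ k)
    (hf : IsIIDConvexLipschitz μ P U L f fstar) (hδ : 0 < δ)
    (hPU : ∀ x ∈ P, Metric.closedBall x (√(n : ℝ) * Metric.diam P) ⊆ U) {T : ℕ} (hT : 1 ≤ T) :
    ∃ G : Set Ω, MeasurableSet G ∧ ENNReal.ofReal (1 - δ) ≤ μ G ∧ ∀ ω ∈ G, ∀ x h Φ v,
      IsLOCGRun P K (4 * √(n : ℝ) * L * Metric.diam P) (-(1 / 3)) 0 0
        (fun t => (t : ℝ) ^ (-(2 / 3) : ℝ))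
        (fun t => smoothing (√(n : ℝ) * Metric.diam P * (t : ℝ) ^ (-(1 / 3) : ℝ)) (f t ω))
        T x h Φ v →
      RegretAtMost P fstar T x (39 * K * (√(n : ℝ) * L * k * (T : ℝ) ^ (2 / 3 : ℝ) +
        L * k * √(n * T * Real.log (n * (T : ℝ) ^ 2 / δ) * Real.log T))) := by
  have hcomp := hP.isCompact
  have hW := Real.sqrt_nonneg (n * T * Real.log (n * (T : ℝ) ^ 2 / δ) * Real.log T)
  have hγ : ∀ t : ℕ, 1 ≤ t → 0 < (t : ℝ) ^ (-(2 / 3) : ℝ) ∧ (t : ℝ) ^ (-(2 / 3) : ℝ) ≤ 1 :=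
    fun t ht => (rpow_neg_stepsize ht (by norm_num)).1
  rcases le_or_gt 1 δ with hδ1 | hδ1
  · exact ⟨∅, MeasurableSet.empty, by simp [ENNReal.ofReal_eq_zero.2 (sub_nonpos.2 hδ1)],
      fun ω hω => absurd hω (Set.notMem_empty ω)⟩
  rcases (mul_nonneg L.coe_nonneg (Metric.diam_nonneg (s := P))).eq_or_lt with hLD | hLD
  · refine ⟨Set.univ, MeasurableSet.univ, by simp [hδ.le], fun ω _ x h Φ v run => ?_⟩
    have hx1 := run.start.1
    have hk0 := Metric.diam_nonneg.trans (diam_le_of_sum_abs_le hk hx1)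
    exact hf.regretAtMost_of_mul_diam_eq_zero hcomp hLD.symm ⟨_, hx1⟩
      (fun t ht htT => run.mem hP.convex hγ ht htT) (by positivity)
  have hD : 0 < Metric.diam P := pos_of_mul_pos_right hLD L.coe_nonneg
  have hn : 1 ≤ n := one_le_dim_of_diam_pos hD
  have hsn : 1 ≤ √(n : ℝ) := Real.one_le_sqrt.2 (by exact_mod_cast hn)
  -- At T = 1 the term with log T vanishes, so the single round is bounded by L D ≤ √n L k.
  rcases hT.eq_or_lt with rfl | hT
  · refine ⟨Set.univ, MeasurableSet.univ, by simp [hδ.le], fun ω _ x h Φ v run => ?_⟩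
    have hx1 := run.start.1
    have hDk := diam_le_of_sum_abs_le hk hx1
    refine hf.regretAtMost hcomp ⟨_, hx1⟩ fun z hz => ?_
    have h1 := hf.mean_sub_le hP.1 hx1 hz
    have h2 : L * Metric.diam P ≤ L * k := by gcongr
    have h3 : L * k ≤ √(n : ℝ) * (L * k) := le_mul_of_one_le_left (hLD.le.trans h2) hsn
    have h4 : √(n : ℝ) * (L * k) ≤ 39 * K * (√(n : ℝ) * (L * k)) :=
      le_mul_of_one_le_left ((hLD.le.trans h2).trans h3) (by linarith)
    simp
    linarith
  obtain ⟨G, hGm, hG, hdev⟩ := hf.exists_uniform_deviation hP.1 hn hLD hT hδ hδ1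
    (Q := fun _ _ => True) (fun _ _ => Filter.Eventually.of_forall fun _ => trivial)
  refine ⟨G, hGm, hG, fun ω hω x h Φ v run => ?_⟩
  obtain ⟨-, hcv, hLip, hdev⟩ := hdev ω hω
  have hx1 := run.start.1
  have hDk := diam_le_of_sum_abs_le hk hx1
  refine hf.regretAtMost hcomp ⟨_, hx1⟩ fun z hz => ?_
  have hS : ∑ t ∈ Finset.Icc 1 T, (t : ℝ) ^ (2 / 3 : ℝ) / t ≤ 3 / 2 * (T : ℝ) ^ (2 / 3 : ℝ) := by
    refine (Finset.sum_congr rfl fun t ht => ?_).trans_le (sum_rpow_neg_one_third_le T)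
    have ht0 : (0 : ℝ) < t := by exact_mod_cast (Finset.mem_Icc.1 ht).1
    rw [← Real.rpow_sub_one ht0.ne']
    norm_num
  refine (sum_le_of_mul_le (s := fun t => (t : ℝ) ^ (2 / 3 : ℝ)) hLD.le
    (Real.sqrt_nonneg (10 * n * Real.log (n * (T : ℝ) ^ 2 / δ)))
    (β := (4 * K + 3) * (√(n : ℝ) * L * Metric.diam P)) (by positivity) (fun t ht htT => ?_)
    hS).trans ?_
  · have hx := run.mem hP.convex hγ ht htT
    have hreg := run.sum_sub_sum_le_of_smoothing hP.convex hP.1 hK hn hD hf.isOpen hPU hcv hLip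
      ht htT hz
    exact (hdev t ht htT _ hx z hz).trans (by gcongr)
  · have hb := mul_le_mul_of_nonneg_left (mul_sqrt_le_deviation hn hT hδ hδ1) hLD.le
    set W := √(n * T * Real.log (n * (T : ℝ) ^ 2 / δ) * Real.log T)
    set D := Metric.diam P
    set V := (T : ℝ) ^ (2 / 3 : ℝ)
    have hV : 0 ≤ V := by positivity
    have hkW : L * D * W ≤ L * k * W := by gcongr
    have hkV : √(n : ℝ) * L * D * V ≤ √(n : ℝ) * L * k * V := by gcongr
    have hLDW : 0 ≤ L * D * W := mul_nonneg hLD.le hW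
    have hLDV : 0 ≤ √(n : ℝ) * L * D * V := by positivity
    calc (4 * K + 3) * (√(n : ℝ) * L * D) * (3 / 2 * V) + _
        ≤ (6 * K + 5) * (√(n : ℝ) * L * D * V) + 26 * (L * D * W) := by linarith
      _ ≤ 39 * K * (√(n : ℝ) * L * D * V) + 39 * K * (L * D * W) := by
          gcongr <;> linarith
      _ ≤ 39 * K * (√(n : ℝ) * L * k * V) + 39 * K * (L * k * W) := by gcongr
      _ = _ := by ring

end

end LazyOnline

theorem mainTheorem10 (K : ℝ) (hK : 1 ≤ K) :
    ∃ c : ℝ, 0 < c ∧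
      ∀ (n : ℕ) (P U : Set (EuclideanSpace ℝ (Fin n))) (k : ℝ) (L : ℝ≥0)
        (Ω : Type*) [MeasurableSpace Ω] (μ : Measure Ω) [IsProbabilityMeasure μ]
        (f : ℕ → Ω → EuclideanSpace ℝ (Fin n) → ℝ)
        (fstar : EuclideanSpace ℝ (Fin n) → ℝ) (δ : ℝ),
        LazyOnline.IsPolytope P →
        (∀ y ∈ P, ∀ z ∈ P, ∑ i, |y i - z i| ≤ k) →
        LazyOnline.IsIIDConvexLipschitz μ P U L f fstar →
        0 < δ →
        -- losses of curvature at most `C`: the algorithm runs on the losses, with `b = 0`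
        (∀ C : ℝ,
          (∀ t, 1 ≤ t → ∀ᵐ ω ∂μ, LazyOnline.HasCurvatureAtMost P (f t ω) C) →
          ∀ T : ℕ, 2 ≤ T →
          ∃ G : Set Ω, MeasurableSet G ∧ ENNReal.ofReal (1 - δ) ≤ μ G ∧
            ∀ ω ∈ G, ∀ x h Φ v,
              LazyOnline.IsLOCGRun P K C 0 0 0 (fun t => (t : ℝ) ^ (-(1 / 2) : ℝ))
                (fun t => f t ω) T x h Φ v →
              LazyOnline.RegretAtMost P fstar T x
                (c * (C * √(T : ℝ) +
                  L * k * √(n * T * Real.log (n * (T : ℝ) ^ 2 / δ) * Real.log T)))) ∧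
        -- arbitrary losses: the algorithm runs on smoothings of the losses at the radii
        -- `√n D t^(-1/3)`, with `b = -1/3`
        ((∀ x ∈ P, Metric.closedBall x (√(n : ℝ) * Metric.diam P) ⊆ U) →
          ∀ T : ℕ, 1 ≤ T →
          ∃ G : Set Ω, MeasurableSet G ∧ ENNReal.ofReal (1 - δ) ≤ μ G ∧
            ∀ ω ∈ G, ∀ x h Φ v,
              LazyOnline.IsLOCGRun P K (4 * √(n : ℝ) * L * Metric.diam P) (-(1 / 3)) 0 0
                (fun t => (t : ℝ) ^ (-(2 / 3) : ℝ))
                (fun t => LazyOnline.smoothing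
                  (√(n : ℝ) * Metric.diam P * (t : ℝ) ^ (-(1 / 3) : ℝ)) (f t ω))
                T x h Φ v →
              LazyOnline.RegretAtMost P fstar T x
                (c * (√(n : ℝ) * L * k * (T : ℝ) ^ (2 / 3 : ℝ) +
                  L * k * √(n * T * Real.log (n * (T : ℝ) ^ 2 / δ) * Real.log T)))) := by
  refine ⟨39 * K, by linarith, ?_⟩
  intro n P U k L Ω _ μ _ f fstar δ hP hk hf hδ
  exact ⟨fun C hC T hT => LazyOnline.exists_regret_event_of_curvature hK hP hk hf hδ hC hT,
    fun hPU T hT => LazyOnline.exists_regret_event_of_smoothing hK hP hk hf hδ hPU hT⟩
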